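/- Let $m,n\ge 1$ and let $\theta$ be a permutation of $\{1,\dots,m\}\times\{1,\dots,n\}$. Let $\mathbb F_\theta^+$ be the unital semigroup generated by $e_1,\dots,e_m,f_1,\dots,f_n$ subject to $e_if_j=f_{j'}e_{i'}$ whenever $\theta(i,j)=(i',j')$, and let $d(w)=(k,l)\in\mathbb Z_+^2$ be the degree of a word $w$ with $k$ letters $e$ and $l$ letters $f$. Let $\mathcal O_\theta$ be the universal C*-algebra generated by isometries $s_u$ ($u\in\mathbb F_\theta^+$) with $s_\emptyset=1$, $s_{uv}=s_us_v$ and $\sum_i s_{e_i}s_{e_i}^*=1=\sum_j s_{f_j}s_{f_j}^*$. For $t\in\mathbb T^2$ let $\gamma_t$ be the gauge automorphism, $\gamma_t(s_w)=t^{d(w)}s_w$, let $\mathfrak F$ be the fixed point algebra of $\gamma$, and let $\Phi(X)=\int_{\mathbb T^2}\gamma_t(X)\,dt\in\mathfrak F$. Write $(m,n)^{(a,b)}=m^an^b$ for $a,b\in\mathbb C$, with $m^a=\exp(a\ln m)$. **Theorem 5.3.** The algebra $\mathfrak F$ has a unique tracial state $\tau$, and $\omega=\tau\circ\Phi$ is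 a state of $\mathcal O_\theta$. The linear span $\mathcal O_{\theta_c}=\operatorname{span}\{s_us_v^*:u,v\in\mathbb F_\theta^+\}$ is a dense *-subalgebra of $\mathcal O_\theta$. There are linear maps $\Delta(z):\mathcal O_{\theta_c}\to\mathcal O_{\theta_c}$ ($z\in\mathbb C$) with $$\Delta(z)(s_us_v^*)=(m,n)^{z(d(v)-d(u))}s_us_v^*,\qquad \Delta(z)(AB)=\Delta(z)(A)\,\Delta(z)(B),$$ and $\mathcal O_{\theta_c}$ with $\langle A|B\rangle=\omega(A^*B)$ and $\Delta$ is a modular Hilbert algebra (Tomita algebra). That is, $\langle\cdot|\cdot\rangle$ is a (positive definite) inner product, $\Delta$ is a one-parameter group of algebra automorphisms indexed by the additive group $\mathbb C$, and, for the norm of the inner product and all $\xi,\eta,\zeta\in\mathcal O_{\theta_c}$, $\alpha\in\mathbb C$: 1. $\langle\xi\eta|\zeta\rangle=\langle\eta|\xi^*\zeta\rangle$; 2. $\eta\mapsto\xi\eta$ is continuous; 3. the span of all products is dense; 4. $(\Delta(\alpha)\xi)^*=\Delta(-\bar\alpha)\xi^*$; 5. $\langle\Delta(\alpha)\xi|\eta\rangle=\langle\xi|\Delta(\bar\alpha)\eta\rangle$;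 6. $\langle\Delta(1)\xi^*|\eta^*\rangle=\langle\eta|\xi\rangle$; 7. $\alpha\mapsto\langle\xi|\Delta(\alpha)\eta\rangle$ is entire; 8. $(1+\Delta(t))\mathcal O_{\theta_c}$ is dense for every $t\in\mathbb R$. Moreover, $\Delta(z)$ is the restriction to $\mathcal O_{\theta_c}$ of the power $\Delta^z$ of the modular operator $\Delta$. Precisely, in the GNS Hilbert space of $\omega$ the antilinear operator $S:A\mapsto A^*$ on $\mathcal O_{\theta_c}$ is closable, the operator $\Delta=F\bar S$ (with $\bar S$ the closure of $S$, $F=S^*$ its adjoint, and the natural domain) is $\int x\,dE(x)$ for a projection valued measure $E$ concentrated on $(0,\infty)$, and for every $z\in\mathbb C$ and $A\in\mathcal O_{\theta_c}$ the vector $A$ lies in the domain of $\Delta^z=\int x^z\,dE(x)$ and $\Delta^zA=\Delta(z)(A)$. -/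

import Mathlib

open scoped ENNReal ComplexOrder

noncomputable section

/-! ### The semigroup of a single-vertex 2-graph -/

/-- The commutation relations `e_i f_j = f_{j'} e_{i'}` whenever `θ (i, j) = (i', j')`.
The letter `e_i` is `Sum.inl i`, the letter `f_j` is `Sum.inr j`. -/
inductive FThetaRel {m n : ℕ} (θ : Equiv.Perm (Fin m × Fin n)) :
    FreeMonoid (Fin m ⊕ Fin n) → FreeMonoid (Fin m ⊕ Fin n) → Prop
  | comm (i : Fin m) (j : Fin n) :
      FThetaRel θ (FreeMonoid.of (Sum.inl i) * FreeMonoid.of (Sum.inr j))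
        (FreeMonoid.of (Sum.inr (θ (i, j)).2) * FreeMonoid.of (Sum.inl (θ (i, j)).1))

/-- The unital semigroup `𝔽_θ⁺` generated by `e_1, …, e_m`, `f_1, …, f_n` subject to the
commutation relations given by `θ`. -/
abbrev FTheta {m n : ℕ} (θ : Equiv.Perm (Fin m × Fin n)) : Type :=
  PresentedMonoid (FThetaRel θ)

namespace FTheta

variable {m n : ℕ} {θ : Equiv.Perm (Fin m × Fin n)}

/-- The generator `e_i`. -/
def e (i : Fin m) : FTheta θ := PresentedMonoid.of (FThetaRel θ) (Sum.inl i)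

/-- The generator `f_j`. -/
def f (j : Fin n) : FTheta θ := PresentedMonoid.of (FThetaRel θ) (Sum.inr j)

/-- The degree as a monoid homomorphism. -/
def degHom : FTheta θ →* Multiplicative (ℕ × ℕ) :=
  PresentedMonoid.lift
    (Sum.elim (fun _ => Multiplicative.ofAdd (1, 0)) (fun _ => Multiplicative.ofAdd (0, 1)))
    (by
      rintro _ _ ⟨i, j⟩
      simp only [map_mul, FreeMonoid.lift_eval_of, Sum.elim_inl, Sum.elim_inr]
      exact mul_comm _ _)

/-- The degree `d(w) = (k, l)`: the word `w` has `k` letters `e` and `l` letters `f`. -/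
def deg (w : FTheta θ) : ℕ × ℕ := Multiplicative.toAdd (degHom w)

theorem deg_one : deg (1 : FTheta θ) = 0 := by simp [deg]

theorem deg_mul (u v : FTheta θ) : deg (u * v) = deg u + deg v := by simp [deg]

theorem deg_e (i : Fin m) : deg (e i : FTheta θ) = (1, 0) := rfl

theorem deg_f (j : Fin n) : deg (f j : FTheta θ) = (0, 1) := rfl

theorem e_mul_f (i : Fin m) (j : Fin n) :
    (e i * f j : FTheta θ) = f (θ (i, j)).2 * e (θ (i, j)).1 :=
  Quotient.sound (ConGen.Rel.of _ _ (FThetaRel.comm i j))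

end FTheta

/-! ### The universal C*-algebra `O_θ` -/

/-- The separable infinite dimensional Hilbert space `ℓ²(ℕ)`. -/
abbrev SeqHilbert : Type := lp (fun _ : ℕ => ℂ) 2

/-- The bounded operators on `ℓ²(ℕ)`. -/
abbrev SeqOp : Type := SeqHilbert →L[ℂ] SeqHilbert

instance : Nontrivial SeqHilbert :=
  ⟨⟨lp.single 2 0 1, 0, fun h => by
    have h0 := congrArg (fun x : SeqHilbert => x 0) h
    simp at h0⟩⟩

/-- A representation on `ℓ²(ℕ)` of the relations defining `O_θ`: isometries `S_u`, `u ∈ 𝔽_θ⁺`,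
with `S_∅ = 1`, `S_{uv} = S_u S_v` and the defect free property. -/
structure ThetaRep {m n : ℕ} (θ : Equiv.Perm (Fin m × Fin n)) where
  S : FTheta θ →* SeqOp
  isometry : ∀ u, star (S u) * S u = 1
  defect_free_e : ∑ i : Fin m, S (FTheta.e i) * star (S (FTheta.e i)) = 1
  defect_free_f : ∑ j : Fin n, S (FTheta.f j) * star (S (FTheta.f j)) = 1

/-- The C*-algebra of all bounded families of operators, indexed by all representations of the
relations on `ℓ²(ℕ)`, with the supremum norm. -/
abbrev RepProduct {m n : ℕ} (θ : Equiv.Perm (Fin m × Fin n)) : Type :=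
  lp (fun _ : ThetaRep θ => SeqOp) ∞

instance {m n : ℕ} (θ : Equiv.Perm (Fin m × Fin n)) : CStarAlgebra (RepProduct θ) where

namespace ThetaRep

variable {m n : ℕ} {θ : Equiv.Perm (Fin m × Fin n)}

theorem eq_of_S {π ρ : ThetaRep θ} (h : π.S = ρ.S) : π = ρ := by
  cases π
  cases ρ
  cases h
  rfl

theorem norm_S_le (π : ThetaRep θ) (u : FTheta θ) : ‖π.S u‖ ≤ 1 := by
  have h : ‖π.S u‖ * ‖π.S u‖ = 1 := by
    rw [← CStarRing.norm_star_mul_self, π.isometry, norm_one]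
  nlinarith [norm_nonneg (π.S u)]

/-- The generators acting in all representations simultaneously. -/
def univS : FTheta θ →* RepProduct θ where
  toFun u := ⟨fun π => π.S u, memℓp_infty ⟨1, by rintro _ ⟨π, rfl⟩; exact π.norm_S_le u⟩⟩
  map_one' := by ext1; funext π; exact map_one π.S
  map_mul' u v := by ext1; funext π; exact map_mul π.S u v

/-- `t^k = t_1^{k_1} t_2^{k_2}` for `t ∈ 𝕋²`. -/
def phase (t : Circle × Circle) (k : ℕ × ℕ) : ℂ := (t.1 : ℂ) ^ k.1 * (t.2 : ℂ) ^ k.2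

theorem phase_add (t : Circle × Circle) (k l : ℕ × ℕ) :
    phase t (k + l) = phase t k * phase t l := by
  simp only [phase, Prod.fst_add, Prod.snd_add, pow_add]
  ring

theorem phase_mul (t r : Circle × Circle) (k : ℕ × ℕ) :
    phase (t * r) k = phase t k * phase r k := by
  simp only [phase, Prod.fst_mul, Prod.snd_mul, Circle.coe_mul, mul_pow]
  ring

theorem star_phase_mul_phase (t : Circle × Circle) (k : ℕ × ℕ) :
    star (phase t k) * phase t k = 1 := by
  rw [Complex.star_def, ← Complex.normSq_eq_conj_mul_self, Complex.normSq_eq_norm_sq]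
  have h : ‖phase t k‖ = 1 := by
    rw [phase, norm_mul, norm_pow, norm_pow, Circle.norm_coe, Circle.norm_coe, one_pow, one_pow,
      one_mul]
  rw [h]
  simp

/-- The representation obtained by multiplying `S_w` by `t^{d(w)}`, `t ∈ 𝕋²`. -/
def twist (t : Circle × Circle) (π : ThetaRep θ) : ThetaRep θ where
  S :=
    { toFun := fun u => phase t (FTheta.deg u) • π.S u
      map_one' := by simp [FTheta.deg_one, phase]
      map_mul' := fun u v => by
        rw [FTheta.deg_mul, map_mul, smul_mul_smul_comm, phase_add] }
  isometry u := by
    change star (phase t (FTheta.deg u) • π.S u) * (phase t (FTheta.deg u) • π.S u) = 1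
    rw [star_smul, smul_mul_smul_comm, star_phase_mul_phase, one_smul, π.isometry]
  defect_free_e := by
    refine Eq.trans (Finset.sum_congr rfl fun i _ => ?_) π.defect_free_e
    change (phase t (FTheta.deg (FTheta.e i)) • π.S (FTheta.e i)) *
      star (phase t (FTheta.deg (FTheta.e i)) • π.S (FTheta.e i)) = _
    rw [star_smul, smul_mul_smul_comm, mul_comm, star_phase_mul_phase, one_smul]
  defect_free_f := by
    refine Eq.trans (Finset.sum_congr rfl fun j _ => ?_) π.defect_free_f
    change (phase t (FTheta.deg (FTheta.f j)) • π.S (FTheta.f j)) *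
      star (phase t (FTheta.deg (FTheta.f j)) • π.S (FTheta.f j)) = _
    rw [star_smul, smul_mul_smul_comm, mul_comm, star_phase_mul_phase, one_smul]

theorem twist_twist (t r : Circle × Circle) (π : ThetaRep θ) :
    (π.twist t).twist r = π.twist (t * r) := by
  refine eq_of_S (MonoidHom.ext fun u => ?_)
  change phase r (FTheta.deg u) • phase t (FTheta.deg u) • π.S u =
    phase (t * r) (FTheta.deg u) • π.S u
  rw [smul_smul, phase_mul, mul_comm]

/-- Permuting the coordinates of the product by `π ↦ twist t π`. -/
def reindex (t : Circle × Circle) : RepProduct θ →⋆ₐ[ℂ] RepProduct θ where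
  toFun x := ⟨fun π => x (π.twist t), memℓp_infty ⟨‖x‖, by
    rintro _ ⟨π, rfl⟩; exact lp.norm_apply_le_norm ENNReal.top_ne_zero x _⟩⟩
  map_one' := rfl
  map_mul' _ _ := rfl
  map_zero' := rfl
  map_add' _ _ := rfl
  commutes' _ := rfl
  map_star' _ := rfl

theorem reindex_univS (t : Circle × Circle) (u : FTheta θ) :
    reindex t (univS u) = phase t (FTheta.deg u) • univS u := rfl

theorem reindex_continuous (t : Circle × Circle) : Continuous (reindex (θ := θ) t) := by
  refine AddMonoidHomClass.continuous_of_bound (reindex (θ := θ) t) 1 fun x => ?_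
  rw [one_mul]
  exact lp.norm_le_of_forall_le (norm_nonneg x) fun π =>
    lp.norm_apply_le_norm ENNReal.top_ne_zero x _

end ThetaRep

section OTheta

variable {m n : ℕ} (θ : Equiv.Perm (Fin m × Fin n))

/-- The C*-subalgebra of the product over all representations generated by the generators. -/
def universalSubalgebra : StarSubalgebra ℂ (RepProduct θ) :=
  (StarAlgebra.adjoin ℂ (Set.range (ThetaRep.univS (θ := θ)))).topologicalClosure

instance : IsClosed (universalSubalgebra θ : Set (RepProduct θ)) :=
  StarSubalgebra.isClosed_topologicalClosure _

/-- The graph C*-algebra `O_θ`: the universal C*-algebra generated by isometries `s_u`,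
`u ∈ 𝔽_θ⁺`, with `s_∅ = 1`, `s_{uv} = s_u s_v` and the defect free property.  The universal norm
of a *-polynomial in the `s_u` is the supremum of its norms over all representations of the
relations.  As a C*-algebra generated by countably many elements is separable, hence acts
faithfully on `ℓ²(ℕ)` (or is zero), it suffices to take the representations on `ℓ²(ℕ)`. -/
def OTheta : Type := universalSubalgebra θ

instance : CStarAlgebra (OTheta θ) := inferInstanceAs (CStarAlgebra (universalSubalgebra θ))

instance : PartialOrder (OTheta θ) := CStarAlgebra.spectralOrder (OTheta θ)

instance : StarOrderedRing (OTheta θ) := CStarAlgebra.spectralOrderedRing (OTheta θ)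

end OTheta

namespace OTheta

variable {m n : ℕ} {θ : Equiv.Perm (Fin m × Fin n)}

/-- The inclusion into the product over all representations. -/
def incl : OTheta θ →⋆ₐ[ℂ] RepProduct θ := (universalSubalgebra θ).subtype

theorem incl_injective : Function.Injective (incl (θ := θ)) := Subtype.val_injective

theorem univS_mem (u : FTheta θ) : ThetaRep.univS u ∈ universalSubalgebra θ :=
  StarSubalgebra.le_topologicalClosure _ (StarAlgebra.subset_adjoin ℂ _ ⟨u, rfl⟩)

/-- The generators `s_u` of `O_θ`. -/
def s : FTheta θ →* OTheta θ where
  toFun u := ⟨ThetaRep.univS u, univS_mem u⟩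
  map_one' := Subtype.ext (map_one ThetaRep.univS)
  map_mul' u v := Subtype.ext (map_mul ThetaRep.univS u v)

/-- Every family satisfying the relations on `ℓ²(ℕ)` extends to a *-representation of `O_θ`. -/
def rep (π : ThetaRep θ) : OTheta θ →⋆ₐ[ℂ] SeqOp where
  toFun X := incl X π
  map_one' := rfl
  map_mul' _ _ := rfl
  map_zero' := rfl
  map_add' _ _ := rfl
  commutes' _ := rfl
  map_star' _ := rfl

theorem rep_s (π : ThetaRep θ) (u : FTheta θ) : rep π (s u) = π.S u := rfl

theorem ext_rep {X Y : OTheta θ} (h : ∀ π : ThetaRep θ, rep π X = rep π Y) : X = Y :=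
  incl_injective (lp.ext (funext h))

theorem star_s_mul_s (u : FTheta θ) : star (s u) * s u = 1 :=
  ext_rep fun π => by rw [map_mul, map_star, rep_s, π.isometry, map_one]

theorem defect_free_e : ∑ i : Fin m, s (θ := θ) (FTheta.e i) * star (s (FTheta.e i)) = 1 :=
  ext_rep fun π => by simp only [map_sum, map_mul, map_star, rep_s, π.defect_free_e, map_one]

theorem defect_free_f : ∑ j : Fin n, s (θ := θ) (FTheta.f j) * star (s (FTheta.f j)) = 1 :=
  ext_rep fun π => by simp only [map_sum, map_mul, map_star, rep_s, π.defect_free_f, map_one]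

theorem reindex_mem (t : Circle × Circle) {x : RepProduct θ} (hx : x ∈ universalSubalgebra θ) :
    ThetaRep.reindex t x ∈ universalSubalgebra θ := by
  have h : universalSubalgebra θ ≤ (universalSubalgebra θ).comap (ThetaRep.reindex t) := by
    refine StarSubalgebra.topologicalClosure_minimal ?_ ?_
    · refine StarAlgebra.adjoin_le ?_
      rintro _ ⟨u, rfl⟩
      change ThetaRep.reindex t (ThetaRep.univS u) ∈ universalSubalgebra θ
      rw [ThetaRep.reindex_univS]
      exact SMulMemClass.smul_mem _ (univS_mem u)
    · exact (StarSubalgebra.isClosed_topologicalClosure _).preimage (ThetaRep.reindex_continuous t)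
  exact h hx

/-- The gauge automorphism `γ_t`, `t ∈ 𝕋²`, with `γ_t(s_w) = t^{d(w)} s_w`. -/
def gauge (t : Circle × Circle) : OTheta θ →⋆ₐ[ℂ] OTheta θ where
  toFun X := ⟨ThetaRep.reindex t (incl X), reindex_mem t X.2⟩
  map_one' := rfl
  map_mul' _ _ := rfl
  map_zero' := rfl
  map_add' _ _ := rfl
  commutes' _ := rfl
  map_star' _ := rfl

theorem gauge_s (t : Circle × Circle) (u : FTheta θ) :
    gauge t (s u) = ThetaRep.phase t (FTheta.deg u) • s u := rfl

theorem gauge_gauge (t r : Circle × Circle) (X : OTheta θ) :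
    gauge t (gauge r X) = gauge (t * r) X := by
  refine ext_rep fun π => ?_
  change incl X ((π.twist t).twist r) = incl X (π.twist (t * r))
  rw [ThetaRep.twist_twist]

variable (θ) in
/-- The fixed point algebra `𝔉` of the gauge action. -/
def fixedAlgebra : StarSubalgebra ℂ (OTheta θ) where
  carrier := {X | ∀ t, gauge t X = X}
  mul_mem' hX hY t := by rw [map_mul, hX t, hY t]
  one_mem' t := map_one _
  add_mem' hX hY t := by rw [map_add, hX t, hY t]
  zero_mem' t := map_zero _
  algebraMap_mem' r t := AlgHomClass.commutes _ r
  star_mem' hX t := by rw [map_star, hX t]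

/-- The point of `𝕋²` with the given angular coordinates in `(ℝ/ℤ)²`. -/
def torusPoint (t : UnitAddCircle × UnitAddCircle) : Circle × Circle :=
  (AddCircle.toCircle t.1, AddCircle.toCircle t.2)

/-- The normalized Haar measure of the torus. -/
def torusMeasure : MeasureTheory.Measure (UnitAddCircle × UnitAddCircle) :=
  AddCircle.haarAddCircle.prod AddCircle.haarAddCircle

/-- `∫_{𝕋²} γ_t(X) dt` for the normalized Haar measure of the torus, as an element of `O_θ`. -/
def gaugeAverage (X : OTheta θ) : OTheta θ :=
  ∫ t, gauge (torusPoint t) X ∂torusMeasure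

theorem gaugeAverage_mem (X : OTheta θ) : gaugeAverage X ∈ fixedAlgebra θ := by
  intro r
  by_cases hi : MeasureTheory.Integrable
      (fun t : UnitAddCircle × UnitAddCircle => gauge (torusPoint t) X) torusMeasure
  · obtain ⟨a, ha⟩ : ∃ a, torusPoint a = r := by
      obtain ⟨a, ha⟩ := (AddCircle.homeomorphCircle (T := 1) one_ne_zero).surjective r.1
      obtain ⟨b, hb⟩ := (AddCircle.homeomorphCircle (T := 1) one_ne_zero).surjective r.2
      rw [AddCircle.homeomorphCircle_apply] at ha hb
      exact ⟨(a, b), Prod.ext ha hb⟩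
    let L : OTheta θ →L[ℂ] OTheta θ :=
      { toFun := gauge r
        map_add' := map_add _
        map_smul' := map_smul _
        cont := map_continuous _ }
    have h1 : gauge r (gaugeAverage X) =
        ∫ t, gauge r (gauge (torusPoint t) X) ∂torusMeasure :=
      (L.integral_comp_comm hi).symm
    have h2 : ∀ t : UnitAddCircle × UnitAddCircle,
        gauge r (gauge (torusPoint t) X) = gauge (torusPoint (a + t)) X := by
      intro t
      rw [gauge_gauge, ← ha]
      simp [torusPoint, AddCircle.toCircle_add]
    rw [h1]
    simp_rw [h2]
    have : torusMeasure.IsAddLeftInvariant := by unfold torusMeasure; infer_instance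
    exact MeasureTheory.integral_add_left_eq_self (μ := torusMeasure)
      (fun t : UnitAddCircle × UnitAddCircle => gauge (torusPoint t) X) a
  · rw [gaugeAverage, MeasureTheory.integral_undef hi, map_zero]

/-- The gauge-invariant expectation `Φ(X) = ∫_{𝕋²} γ_t(X) dt` onto the fixed point algebra. -/
def Phi (X : OTheta θ) : fixedAlgebra θ := ⟨gaugeAverage X, gaugeAverage_mem X⟩

end OTheta

/-- A tracial state (a normalized trace) on a unital *-algebra. -/
structure IsTracialState {A : Type*} [Ring A] [StarRing A] [Algebra ℂ A] (τ : A →ₗ[ℂ] ℂ) :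
    Prop where
  map_one : τ 1 = 1
  nonneg : ∀ a, 0 ≤ τ (star a * a)
  trace : ∀ a b, τ (a * b) = τ (b * a)

/-! ### Modular Hilbert algebras -/

/-- An involutive algebra `𝔄` with an inner product `ip`, linear in the second variable, and a
complex one-parameter group `Δ` of automorphisms is a modular Hilbert algebra (Tomita algebra).
Density and continuity refer to the norm `‖ξ‖² = ip ξ ξ`. -/
structure IsModularHilbertAlgebra {𝔄 : Type*} [NonUnitalRing 𝔄] [StarRing 𝔄] [Module ℂ 𝔄]
    [StarModule ℂ 𝔄] [IsScalarTower ℂ 𝔄 𝔄] [SMulCommClass ℂ 𝔄 𝔄]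
    (ip : 𝔄 → 𝔄 → ℂ) (Δ : ℂ → 𝔄 →ₗ[ℂ] 𝔄) : Prop where
  /- `ip` is an inner product -/
  ip_add : ∀ ξ η ζ, ip ξ (η + ζ) = ip ξ η + ip ξ ζ
  ip_smul : ∀ (c : ℂ) ξ η, ip ξ (c • η) = c * ip ξ η
  ip_symm : ∀ ξ η, ip η ξ = star (ip ξ η)
  ip_nonneg : ∀ ξ, 0 ≤ ip ξ ξ
  ip_definite : ∀ ξ, ip ξ ξ = 0 → ξ = 0
  /- `Δ` is a one-parameter group of automorphisms of the algebra -/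
  group_zero : ∀ ξ, Δ 0 ξ = ξ
  group_add : ∀ α β ξ, Δ (α + β) ξ = Δ α (Δ β ξ)
  map_mul : ∀ α ξ η, Δ α (ξ * η) = Δ α ξ * Δ α η
  /- left multiplication: compatible with the involution and continuous -/
  ip_mul_left : ∀ ξ η ζ, ip (ξ * η) ζ = ip η (star ξ * ζ)
  mul_continuous : ∀ ξ, ∃ C : ℝ, ∀ η, (ip (ξ * η) (ξ * η)).re ≤ C * (ip η η).re
  /- the span of all products is dense -/
  mul_dense : ∀ ξ, ∀ ε > (0 : ℝ), ∃ η ∈ Submodule.span ℂ {x : 𝔄 | ∃ a b, x = a * b},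
    (ip (ξ - η) (ξ - η)).re < ε
  star_group : ∀ α ξ, star (Δ α ξ) = Δ (-(starRingEnd ℂ α)) (star ξ)
  ip_group : ∀ α ξ η, ip (Δ α ξ) η = ip ξ (Δ (starRingEnd ℂ α) η)
  ip_star : ∀ ξ η, ip (Δ 1 (star ξ)) (star η) = ip η ξ
  analytic : ∀ ξ η, Differentiable ℂ fun α => ip ξ (Δ α η)
  dense_one_add : ∀ t : ℝ, ∀ ξ, ∀ ε > (0 : ℝ), ∃ η : 𝔄,
    (ip (ξ - (η + Δ t η)) (ξ - (η + Δ t η))).re < ε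

/-! ### The modular operator and its complex powers -/

section Unbounded

variable {H : Type*} [NormedAddCommGroup H] [InnerProductSpace ℂ H]

/-- The graph of the closure of the densely defined antilinear operator `S : ι A ↦ ι A*`. -/
def tomitaClosure {𝔄 : Type*} [Star 𝔄] (ι : 𝔄 → H) : Set (H × H) :=
  closure (Set.range fun A => (ι A, ι (star A)))

/-- The graph of the adjoint `F` of `S`: `F η = ζ` iff `⟨S ξ | η⟩ = ⟨ζ | ξ⟩` for all `ξ` in the
domain of `S`. -/
def tomitaAdjoint {𝔄 : Type*} [Star 𝔄] (ι : 𝔄 → H) : Set (H × H) :=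
  {p | ∀ A, inner ℂ (ι (star A)) p.1 = inner ℂ p.2 (ι A)}

/-- The operator `S` is closable and `T` is the modular operator `F S̄`, with its natural domain. -/
def IsModularOperator {𝔄 : Type*} [Star 𝔄] (ι : 𝔄 → H) (T : H →ₗ.[ℂ] H) : Prop :=
  (∀ η, (0, η) ∈ tomitaClosure ι → η = 0) ∧
  ∀ ξ ζ, (ξ, ζ) ∈ T.graph ↔ ∃ η, (ξ, η) ∈ tomitaClosure ι ∧ (η, ζ) ∈ tomitaAdjoint ι

/-- A spectral (projection valued) measure on `ℝ`.  Its countable additivity is expressed by the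
fact that the set functions `B ↦ ‖E(B) ξ‖² = ⟨ξ | E(B) ξ⟩` are measures. -/
structure SpectralMeasure (H : Type*) [NormedAddCommGroup H] [InnerProductSpace ℂ H]
    [CompleteSpace H] where
  proj : Set ℝ → H →L[ℂ] H
  isStarProjection : ∀ B, MeasurableSet B → IsStarProjection (proj B)
  proj_univ : proj Set.univ = 1
  proj_inter : ∀ B C, MeasurableSet B → MeasurableSet C → proj (B ∩ C) = proj B * proj C
  scalar : H → MeasureTheory.Measure ℝ
  scalar_apply : ∀ ξ B, MeasurableSet B → scalar ξ B = ENNReal.ofReal (‖proj B ξ‖ ^ 2)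

/-- `T = ∫ f dE` as an unbounded operator: its domain is `{ξ | ∫ |f|² d‖Eξ‖² < ∞}`, and
`⟨ξ | T ξ⟩ = ∫ f d‖Eξ‖²` there. -/
def SpectralMeasure.IsIntegral [CompleteSpace H] (E : SpectralMeasure H) (f : ℝ → ℂ)
    (T : H →ₗ.[ℂ] H) : Prop :=
  (∀ ξ, ξ ∈ T.domain ↔ ∫⁻ x, ‖f x‖ₑ ^ 2 ∂(E.scalar ξ) < ∞) ∧
  ∀ ξ : T.domain, inner ℂ (ξ : H) (T ξ) = ∫ x, f x ∂(E.scalar ξ)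

/-- `R = T^z` in the sense of the spectral functional calculus, for a positive self-adjoint
injective operator `T`: for the spectral measure `E` of `T`, which is concentrated on `(0, ∞)`,
`T = ∫ x dE(x)` and `R = ∫ x^z dE(x)`. -/
def IsComplexPower [CompleteSpace H] (T : H →ₗ.[ℂ] H) (z : ℂ) (R : H →ₗ.[ℂ] H) : Prop :=
  ∃ E : SpectralMeasure H, E.proj (Set.Iic 0) = 0 ∧
    E.IsIntegral (fun x => (x : ℂ)) T ∧ E.IsIntegral (fun x => (x : ℂ) ^ z) R

end Unbounded

/-- The canonical map of `O_θ` into the GNS Hilbert space of a positive functional. -/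
def gnsVector {m n : ℕ} {θ : Equiv.Perm (Fin m × Fin n)} (ω : OTheta θ →ₚ[ℂ] ℂ)
    (X : OTheta θ) : ω.GNS :=
  ((ω.toPreGNS X : ω.PreGNS) : UniformSpace.Completion ω.PreGNS)

end

noncomputable section

/-! ### Diagonal operators on a Hilbert sum -/

section Diagonal

variable {I H : Type*} [NormedAddCommGroup H] [InnerProductSpace ℂ H]
  {G : I → Type*} [∀ i, NormedAddCommGroup (G i)] [∀ i, InnerProductSpace ℂ (G i)]

/-- The graph of the diagonal operator with the entries `c`. -/
def diagGraph (U : H ≃ₗᵢ[ℂ] lp G 2) (c : I → ℂ) : Submodule ℂ (H × H) where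
  carrier := {p | ∀ i, U p.2 i = c i • U p.1 i}
  add_mem' {p q} hp hq i := by
    simp only [Prod.snd_add, Prod.fst_add, map_add, lp.coeFn_add, Pi.add_apply, hp i, hq i,
      smul_add]
  zero_mem' i := by simp
  smul_mem' r p hp i := by
    simp only [Prod.smul_snd, Prod.smul_fst, map_smul, lp.coeFn_smul, Pi.smul_apply, hp i]
    rw [smul_comm]

theorem hilbertSum_ext (U : H ≃ₗᵢ[ℂ] lp G 2) {ξ η : H} (h : ∀ i, U ξ i = U η i) : ξ = η :=
  U.injective (lp.ext (funext h))

theorem hilbertSum_hasSum_norm_sq (U : H ≃ₗᵢ[ℂ] lp G 2) (ξ : H) :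
    HasSum (fun i => ‖U ξ i‖ ^ 2) (‖ξ‖ ^ 2) := by
  have h := lp.hasSum_norm (p := 2) (by norm_num) (U ξ)
  simpa [U.norm_map] using h

theorem hilbertSum_hasSum_inner (U : H ≃ₗᵢ[ℂ] lp G 2) (ξ η : H) :
    HasSum (fun i => inner ℂ (U ξ i) (U η i)) (inner ℂ ξ η) := by
  have h := lp.hasSum_inner (𝕜 := ℂ) (U ξ) (U η)
  rwa [U.inner_map_map] at h

theorem hilbertSum_exists (U : H ≃ₗᵢ[ℂ] lp G 2) (x : ∀ i, G i)
    (hx : Summable fun i => ‖x i‖ ^ 2) : ∃ ξ, ∀ i, U ξ i = x i := by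
  have hm : Memℓp x 2 := by
    refine (memℓp_gen_iff (by norm_num)).2 ?_
    simpa using hx
  refine ⟨U.symm ⟨x, hm⟩, fun i => ?_⟩
  rw [LinearIsometryEquiv.apply_symm_apply]

/-- The diagonal operator with the entries `c`, with its maximal domain. -/
def diagOp (U : H ≃ₗᵢ[ℂ] lp G 2) (c : I → ℂ) : H →ₗ.[ℂ] H := (diagGraph U c).toLinearPMap

/-- `Submodule.toLinearPMap` has the given submodule as its graph only if that submodule is single
valued; here the coordinates determine a vector, so it is. -/
theorem mem_graph_diagOp (U : H ≃ₗᵢ[ℂ] lp G 2) (c : I → ℂ) (p : H × H) :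
    p ∈ (diagOp U c).graph ↔ ∀ i, U p.2 i = c i • U p.1 i := by
  rw [diagOp, Submodule.toLinearPMap_graph_eq]
  · rfl
  · intro x hx h0
    refine hilbertSum_ext U fun i => ?_
    rw [hx i, h0]
    simp

theorem diagOp_apply (U : H ≃ₗᵢ[ℂ] lp G 2) (c : I → ℂ) (ξ : (diagOp U c).domain) (i : I) :
    U (diagOp U c ξ) i = c i • U (ξ : H) i :=
  (mem_graph_diagOp U c (ξ, diagOp U c ξ)).1 (LinearPMap.mem_graph _ ξ) i

theorem mem_domain_diagOp (U : H ≃ₗᵢ[ℂ] lp G 2) (c : I → ℂ) (ξ : H) :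
    ξ ∈ (diagOp U c).domain ↔ Summable fun i => ‖c i‖ ^ 2 * ‖U ξ i‖ ^ 2 := by
  constructor
  · intro h
    have hs := (hilbertSum_hasSum_norm_sq U (diagOp U c ⟨ξ, h⟩)).summable
    refine hs.congr fun i => ?_
    rw [diagOp_apply, norm_smul, mul_pow]
  · intro h
    obtain ⟨ζ, hζ⟩ := hilbertSum_exists U (fun i => c i • U ξ i)
      (h.congr fun i => by rw [norm_smul, mul_pow])
    exact LinearPMap.mem_domain_of_mem_graph ((mem_graph_diagOp U c (ξ, ζ)).2 hζ)

/-- The vectors whose coordinates outside of `S` vanish. -/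
def coordSubspace (U : H ≃ₗᵢ[ℂ] lp G 2) (S : Set I) : Submodule ℂ H where
  carrier := {ξ | ∀ i, i ∉ S → U ξ i = 0}
  add_mem' {ξ η} hξ hη i hi := by simp [hξ i hi, hη i hi]
  zero_mem' i _ := by simp
  smul_mem' r ξ hξ i hi := by simp [hξ i hi]

theorem continuous_coord (U : H ≃ₗᵢ[ℂ] lp G 2) (i : I) : Continuous fun ξ => U ξ i := by
  have h : ∀ ξ : H, ‖U ξ i‖ ≤ 1 * ‖ξ‖ := fun ξ => by
    rw [one_mul, ← U.norm_map]
    exact lp.norm_apply_le_norm (by norm_num) _ i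
  exact AddMonoidHomClass.continuous_of_bound
    ({ toFun := fun ξ => U ξ i
       map_zero' := by simp
       map_add' := fun _ _ => by simp } : H →+ G i) 1 h

theorem isClosed_coordSubspace (U : H ≃ₗᵢ[ℂ] lp G 2) (S : Set I) :
    IsClosed (coordSubspace U S : Set H) := by
  have : (coordSubspace U S : Set H) = ⋂ i, ⋂ (_ : i ∉ S), {ξ | U ξ i = 0} := by
    ext ξ; simp [coordSubspace]
  rw [this]
  exact isClosed_iInter fun i => isClosed_iInter fun _ =>
    isClosed_eq (continuous_coord U i) continuous_const

variable [CompleteSpace H]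

instance (U : H ≃ₗᵢ[ℂ] lp G 2) (S : Set I) : CompleteSpace (coordSubspace U S) :=
  (isClosed_coordSubspace U S).completeSpace_coe

/-- The projection onto the coordinates in `S`. -/
def coordProj (U : H ≃ₗᵢ[ℂ] lp G 2) (S : Set I) : H →L[ℂ] H := (coordSubspace U S).starProjection

-- The truncation of ξ lies in the coordinate subspace and its difference from ξ is orthogonal to
-- it, which characterizes the orthogonal projection.
open Classical in
theorem coordProj_apply (U : H ≃ₗᵢ[ℂ] lp G 2) (S : Set I) (ξ : H) (i : I) :
    U (coordProj U S ξ) i = if i ∈ S then U ξ i else 0 := by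
  obtain ⟨η, hη⟩ := hilbertSum_exists U (fun i => if i ∈ S then U ξ i else 0)
    ((hilbertSum_hasSum_norm_sq U ξ).summable.of_nonneg_of_le (fun _ => sq_nonneg _) fun i => by
      split_ifs
      · exact le_rfl
      · simp)
  have : coordProj U S ξ = η := by
    refine Submodule.eq_starProjection_of_mem_of_inner_eq_zero ?_ ?_
    · intro i hi
      rw [hη, if_neg hi]
    · intro w hw
      refine (hilbertSum_hasSum_inner U (ξ - η) w).unique ?_
      convert hasSum_zero with i
      by_cases hi : i ∈ S
      · simp [hη, hi]
      · simp [hw i hi]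
  rw [this, hη]

/-- The spectral measure of a diagonal operator with the real entries `l`. -/
def diagSpectral (U : H ≃ₗᵢ[ℂ] lp G 2) (l : I → ℝ) : SpectralMeasure H where
  proj B := coordProj U (l ⁻¹' B)
  isStarProjection B _ := isStarProjection_starProjection
  proj_univ := by
    ext ξ
    refine hilbertSum_ext U fun i => ?_
    rw [coordProj_apply]
    simp
  proj_inter B C _ _ := by
    ext ξ
    refine hilbertSum_ext U fun i => ?_
    simp only [mul_apply_eq_comp, coordProj_apply, Set.mem_preimage, Set.mem_inter_iff]
    split_ifs <;> simp_all
  scalar ξ := MeasureTheory.Measure.sum fun i =>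
    ENNReal.ofReal (‖U ξ i‖ ^ 2) • MeasureTheory.Measure.dirac (l i)
  scalar_apply ξ B hB := by
    rw [MeasureTheory.Measure.sum_apply _ hB]
    have h := hilbertSum_hasSum_norm_sq U (coordProj U (l ⁻¹' B) ξ)
    rw [← h.tsum_eq, ENNReal.ofReal_tsum_of_nonneg (fun _ => by positivity) h.summable]
    refine tsum_congr fun i => ?_
    rw [coordProj_apply, MeasureTheory.Measure.smul_apply, MeasureTheory.Measure.dirac_apply' _ hB]
    by_cases hi : l i ∈ B <;> simp [hi]

theorem diagSpectral_proj_eq_zero (U : H ≃ₗᵢ[ℂ] lp G 2) {l : I → ℝ} {B : Set ℝ}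
    (h : ∀ i, l i ∉ B) : (diagSpectral U l).proj B = 0 := by
  ext ξ
  refine hilbertSum_ext U fun i => ?_
  change U (coordProj U (l ⁻¹' B) ξ) i = _
  rw [coordProj_apply]
  exact (if_neg (h i)).trans (by simp)

/-- The scalar measure of ξ is a sum of point masses ‖ξ_i‖² at `l i`, so both integrals become
series over `I`. Point masses need no measurability of `f`. -/
theorem isIntegral_diagOp [Countable I] (U : H ≃ₗᵢ[ℂ] lp G 2) (l : I → ℝ) (f : ℝ → ℂ) :
    (diagSpectral U l).IsIntegral f (diagOp U fun i => f (l i)) := by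
  have hdom : ∀ ξ, ξ ∈ (diagOp U fun i => f (l i)).domain ↔
      Summable fun i => ‖f (l i)‖ ^ 2 * ‖U ξ i‖ ^ 2 := mem_domain_diagOp U _
  constructor
  · intro ξ
    rw [hdom]
    change _ ↔ ∫⁻ x, ‖f x‖ₑ ^ 2 ∂(MeasureTheory.Measure.sum fun i =>
      ENNReal.ofReal (‖U ξ i‖ ^ 2) • MeasureTheory.Measure.dirac (l i)) < ∞
    rw [MeasureTheory.lintegral_sum_measure]
    have h : ∀ i, ∫⁻ x, ‖f x‖ₑ ^ 2 ∂(ENNReal.ofReal (‖U ξ i‖ ^ 2) •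
        MeasureTheory.Measure.dirac (l i)) = ENNReal.ofReal (‖f (l i)‖ ^ 2 * ‖U ξ i‖ ^ 2) := by
      intro i
      rw [MeasureTheory.lintegral_smul_measure, MeasureTheory.lintegral_dirac, smul_eq_mul,
        mul_comm, ENNReal.ofReal_mul (by positivity), ENNReal.ofReal_pow (norm_nonneg (f (l i))),
        ofReal_norm]
    simp_rw [h]
    constructor
    · intro hs
      rw [← ENNReal.ofReal_tsum_of_nonneg (fun _ => by positivity) hs]
      exact ENNReal.ofReal_lt_top
    · intro hlt
      have := ENNReal.summable_toReal hlt.ne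
      refine this.congr fun i => ?_
      rw [ENNReal.toReal_ofReal (by positivity)]
  · intro ξ
    have hs := (hdom ξ).1 ξ.2
    have h0 := (hilbertSum_hasSum_norm_sq U (ξ : H)).summable
    have hint : Summable fun i => (ENNReal.ofReal (‖U (ξ : H) i‖ ^ 2)).toReal * ‖f (l i)‖ := by
      refine Summable.of_nonneg_of_le (fun _ => by positivity) (fun i => ?_) (hs.add h0)
      rw [ENNReal.toReal_ofReal (by positivity)]
      -- Integrability of f follows from |f| ≤ |f|² + 1 and the finite total mass.
      nlinarith [mul_nonneg (sq_nonneg (‖f (l i)‖ - 1)) (sq_nonneg ‖U (ξ : H) i‖),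
        mul_nonneg (norm_nonneg (f (l i))) (sq_nonneg ‖U (ξ : H) i‖)]
    refine (hilbertSum_hasSum_inner U (ξ : H) _).unique ?_
    have e : (fun i => inner ℂ (U (ξ : H) i) (U (diagOp U (fun i => f (l i)) ξ) i)) =
        fun i => (ENNReal.ofReal (‖U (ξ : H) i‖ ^ 2)).toReal • f (l i) := by
      funext i
      rw [diagOp_apply, inner_smul_right, inner_self_eq_norm_sq_to_K,
        ENNReal.toReal_ofReal (by positivity), Complex.real_smul, mul_comm]
      simp
    rw [e]
    exact MeasureTheory.hasSum_integral_sum_dirac (fun _ => ENNReal.ofReal_ne_top) hint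

end Diagonal
end

noncomputable section

/-! ### Existence of a representation -/

section Tilings

variable {m n : ℕ} (θ : Equiv.Perm (Fin m × Fin n))

/-- An infinite path of the 2-graph: a labelling of the edges of the quarter plane such that all
squares commute. -/
@[ext]
structure InfPath where
  -- `a p q` labels the edge from (p, q) to (p+1, q), and `b p q` the edge from (p, q) to (p, q+1);
  -- `comm` equates the two ways around a unit square.
  a : ℕ → ℕ → Fin m
  b : ℕ → ℕ → Fin n
  comm : ∀ p q, θ (a p q, b (p + 1) q) = (a p (q + 1), b p q)

namespace InfPath

variable {θ}

/-- Removing the first letter `e`. -/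
def shiftE (x : InfPath θ) : InfPath θ where
  a p q := x.a (p + 1) q
  b p q := x.b (p + 1) q
  comm p q := x.comm (p + 1) q

/-- Removing the first letter `f`. -/
def shiftF (x : InfPath θ) : InfPath θ where
  a p q := x.a p (q + 1)
  b p q := x.b p (q + 1)
  comm p q := x.comm p (q + 1)

/-- The first column of `e_i x`. -/
def colE (i : Fin m) (x : InfPath θ) : ℕ → Fin m
  | 0 => i
  | q + 1 => (θ (colE i x q, x.b 0 q)).1

/-- The first row of `f_j x`. -/
def rowF (j : Fin n) (x : InfPath θ) : ℕ → Fin n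
  | 0 => j
  | p + 1 => (θ.symm (x.a p 0, rowF j x p)).2

/-- The infinite path `e_i x`. -/
def consE (i : Fin m) (x : InfPath θ) : InfPath θ where
  a p q := p.casesOn (colE i x q) fun p => x.a p q
  b p q := p.casesOn (θ (colE i x q, x.b 0 q)).2 fun p => x.b p q
  comm p q := by
    cases p with
    | zero => rfl
    | succ p => exact x.comm p q

/-- The infinite path `f_j x`. -/
def consF (j : Fin n) (x : InfPath θ) : InfPath θ where
  a p q := q.casesOn (θ.symm (x.a p 0, rowF j x p)).1 fun q => x.a p q
  b p q := q.casesOn (rowF j x p) fun q => x.b p q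
  comm p q := by
    cases q with
    | zero => exact θ.apply_symm_apply _
    | succ q => exact x.comm p q

theorem colE_shiftE (x : InfPath θ) (q : ℕ) : colE (x.a 0 0) (shiftE x) q = x.a 0 q := by
  induction q with
  | zero => rfl
  | succ q ih =>
    rw [colE, ih]
    exact congrArg Prod.fst (x.comm 0 q)

theorem rowF_shiftF (x : InfPath θ) (p : ℕ) : rowF (x.b 0 0) (shiftF x) p = x.b p 0 := by
  induction p with
  | zero => rfl
  | succ p ih =>
    rw [rowF, ih]
    refine congrArg Prod.snd ((Equiv.symm_apply_eq θ).2 (x.comm p 0).symm : _ = (_, _))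

theorem consE_shiftE (x : InfPath θ) : consE (x.a 0 0) (shiftE x) = x := by
  ext p q
  · cases p with
    | zero => exact congrArg _ (colE_shiftE x q)
    | succ p => rfl
  · cases p with
    | zero =>
      change ((θ (colE (x.a 0 0) (shiftE x) q, x.b 1 q)).2 : ℕ) = _
      rw [colE_shiftE, x.comm 0 q]
    | succ p => rfl

theorem consF_shiftF (x : InfPath θ) : consF (x.b 0 0) (shiftF x) = x := by
  ext p q
  · cases q with
    | zero =>
      change ((θ.symm (x.a p 1, rowF (x.b 0 0) (shiftF x) p)).1 : ℕ) = _
      rw [rowF_shiftF, (Equiv.symm_apply_eq θ).2 (x.comm p 0).symm]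
    | succ q => rfl
  · cases q with
    | zero => exact congrArg _ (rowF_shiftF x p)
    | succ q => rfl

/-- Any path is rebuilt from its first `f`, its next `e` and the remaining tail. For the path e_i
f_j x these two letters are the ones prescribed by θ and the tail is x, all by unfolding. -/
theorem consE_consF (i : Fin m) (j : Fin n) (x : InfPath θ) :
    consE i (consF j x) = consF (θ (i, j)).2 (consE (θ (i, j)).1 x) := by
  have h := consF_shiftF (consE i (consF j x))
  have h2 := consE_shiftE (shiftF (consE i (consF j x)))
  rw [← h, ← h2]
  rfl

/-- The infinite path that is constant along the diagonals. -/
def diagonal (k : Fin m × Fin n) : InfPath θ where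
  a p q := ((θ ^ ((q : ℤ) - p)) k).1
  b p q := ((θ ^ ((q : ℤ) - p + 1)) k).2
  -- The edges through the corner (p+1, q) carry the two components of θ^(q-p) k, and the opposite
  -- two edges those of its image under θ.
  comm p q := by
    have e1 : ((q : ℤ) - (p + 1 : ℕ) + 1) = q - p := by push_cast; ring
    have e2 : (((q + 1 : ℕ) : ℤ) - p) = 1 + (q - p) := by push_cast; ring
    have e3 : ((q : ℤ) - p + 1) = 1 + (q - p) := by ring
    rw [e1, e2, e3, zpow_add, zpow_one]
    rfl

/-- The four operations on infinite paths. -/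
def op : Fin m ⊕ Fin n ⊕ Bool → InfPath θ → InfPath θ
  | .inl i => consE i
  | .inr (.inl j) => consF j
  | .inr (.inr true) => shiftE
  | .inr (.inr false) => shiftF

/-- The countable set of infinite paths generated by one of them. -/
def orbit (x : InfPath θ) : Set (InfPath θ) :=
  Set.range fun w : List (Fin m ⊕ Fin n ⊕ Bool) => w.foldr op x

theorem op_mem_orbit {x y : InfPath θ} (g : Fin m ⊕ Fin n ⊕ Bool) (hy : y ∈ orbit x) :
    op g y ∈ orbit x := by
  obtain ⟨w, rfl⟩ := hy
  exact ⟨g :: w, rfl⟩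

instance (x : InfPath θ) : Countable (orbit x) := (Set.countable_range _).to_subtype

instance (x : InfPath θ) : Nonempty (orbit x) := ⟨⟨x, [], rfl⟩⟩

end InfPath

/-- There are actions of the generators on `ℕ` by injections whose ranges partition `ℕ`. -/
theorem exists_nat_action (hm : 1 ≤ m) (hn : 1 ≤ n) :
    ∃ (E : Fin m × ℕ ≃ ℕ) (F : Fin n × ℕ ≃ ℕ), ∀ i j k,
      E (i, F (j, k)) = F ((θ (i, j)).2, E ((θ (i, j)).1, k)) := by
  let x₀ : InfPath θ := InfPath.diagonal (⟨0, hm⟩, ⟨0, hn⟩)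
  let X := InfPath.orbit x₀
  -- The orbit may be finite (a single path when m = n = 1); the factor ℕ makes it countably
  -- infinite.
  obtain ⟨c⟩ : Nonempty (X × ℕ ≃ ℕ) := ⟨(nonempty_denumerable (X × ℕ)).some.eqv⟩
  let E : Fin m × X ≃ X :=
    { toFun := fun p => ⟨InfPath.consE p.1 p.2, InfPath.op_mem_orbit (.inl p.1) p.2.2⟩
      invFun := fun x => (x.1.a 0 0,
        ⟨InfPath.shiftE x.1, InfPath.op_mem_orbit (.inr (.inr true)) x.2⟩)
      left_inv := fun _ => rfl
      right_inv := fun x => Subtype.ext (InfPath.consE_shiftE x.1) }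
  let F : Fin n × X ≃ X :=
    { toFun := fun p => ⟨InfPath.consF p.1 p.2, InfPath.op_mem_orbit (.inr (.inl p.1)) p.2.2⟩
      invFun := fun x => (x.1.b 0 0,
        ⟨InfPath.shiftF x.1, InfPath.op_mem_orbit (.inr (.inr false)) x.2⟩)
      left_inv := fun _ => rfl
      right_inv := fun x => Subtype.ext (InfPath.consF_shiftF x.1) }
  let lift : ∀ k : ℕ, (Fin k × X ≃ X) → (Fin k × ℕ ≃ ℕ) := fun k G =>
    (((Equiv.refl _).prodCongr c.symm).trans (Equiv.prodAssoc _ _ _).symm).trans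
      ((G.prodCongr (Equiv.refl ℕ)).trans c)
  have hl : ∀ (k : ℕ) (G : Fin k × X ≃ X) (i : Fin k) (x : X) (l : ℕ),
      lift k G (i, c (x, l)) = c (G (i, x), l) := by
    intro k G i x l
    simp [lift]
  refine ⟨lift m E, lift n F, fun i j k => ?_⟩
  obtain ⟨⟨x, l⟩, rfl⟩ := c.surjective k
  rw [hl, hl, hl, hl]
  congr 2
  exact Subtype.ext (InfPath.consE_consF i j x.1)

end Tilings

/-! ### Isometries of `ℓ²(ℕ)` induced by injections of `ℕ` -/

section Isometries

/-- The standard basis of `ℓ²(ℕ)`. -/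
def seqVec (k : ℕ) : SeqHilbert := lp.single 2 k (1 : ℂ)

theorem inner_seqVec (k : ℕ) (ξ : SeqHilbert) : inner ℂ (seqVec k) ξ = ξ k := by
  rw [seqVec, lp.inner_single_left]
  simp

theorem orthonormal_seqVec : Orthonormal ℂ seqVec := by
  rw [orthonormal_iff_ite]
  intro i j
  rw [inner_seqVec]
  change (Pi.single j (1 : ℂ) : ℕ → ℂ) i = _
  rw [Pi.single_apply]

theorem seqOp_ext {A B : SeqOp} (h : ∀ k, A (seqVec k) = B (seqVec k)) : A = B := by
  let b : HilbertBasis ℕ ℂ SeqHilbert := ⟨LinearIsometryEquiv.refl ℂ _⟩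
  have hb : ∀ k, b k = seqVec k := fun k => by rw [← b.repr_symm_single]; rfl
  refine ContinuousLinearMap.ext_on (s := Set.range b)
    ((Submodule.dense_iff_topologicalClosure_eq_top).2 b.dense_span) ?_
  rintro _ ⟨k, rfl⟩
  rw [hb, h]

theorem orthonormal_seqVec_comp {g : ℕ → ℕ} (hg : Function.Injective g) :
    Orthonormal ℂ fun k => seqVec (g k) :=
  orthonormal_seqVec.comp g hg

/-- The isometry of `ℓ²(ℕ)` that maps the standard basis by an injection. -/
def injIsometry {g : ℕ → ℕ} (hg : Function.Injective g) : SeqOp :=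
  (orthonormal_seqVec_comp hg).orthogonalFamily.linearIsometry.toContinuousLinearMap

theorem injIsometry_apply {g : ℕ → ℕ} (hg : Function.Injective g) (k : ℕ) :
    injIsometry hg (seqVec k) = seqVec (g k) := by
  change (orthonormal_seqVec_comp hg).orthogonalFamily.linearIsometry (lp.single 2 k (1 : ℂ)) = _
  rw [OrthogonalFamily.linearIsometry_apply_single]
  simp

theorem star_injIsometry_mul {g : ℕ → ℕ} (hg : Function.Injective g) :
    star (injIsometry hg) * injIsometry hg = 1 :=
  (ContinuousLinearMap.norm_map_iff_adjoint_comp_self _).1 fun ξ =>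
    LinearIsometry.norm_map _ ξ

theorem star_injIsometry_apply_of_notMem {g : ℕ → ℕ} (hg : Function.Injective g) {y : ℕ}
    (hy : y ∉ Set.range g) : star (injIsometry hg) (seqVec y) = 0 := by
  ext k
  rw [← inner_seqVec, ContinuousLinearMap.star_eq_adjoint,
    ContinuousLinearMap.adjoint_inner_right, injIsometry_apply,
    orthonormal_iff_ite.1 orthonormal_seqVec, if_neg fun h => hy ⟨k, h⟩]
  rfl

/-- Since `E` is a bijection, each basis vector lies in the range of exactly one of the isometries,
and the adjoints of the others annihilate it. -/
theorem sum_injIsometry_mul_star {k : ℕ} (E : Fin k × ℕ ≃ ℕ)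
    (hE : ∀ i, Function.Injective fun l => E (i, l)) :
    ∑ i, injIsometry (hE i) * star (injIsometry (hE i)) = 1 := by
  refine seqOp_ext fun y => ?_
  obtain ⟨⟨i, l⟩, rfl⟩ := E.surjective y
  rw [sum_apply, Finset.sum_eq_single i]
  · rw [← injIsometry_apply (hE i) l, mul_apply_eq_comp,
      ← mul_apply_eq_comp (star _), star_injIsometry_mul]
    rfl
  · intro j _ hj
    rw [mul_apply_eq_comp, star_injIsometry_apply_of_notMem, map_zero]
    rintro ⟨l', h⟩
    exact hj (congrArg Prod.fst (E.injective h))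
  · simp

end Isometries

/-- This is what excludes `OTheta θ = 0`, in which case there would be no normalized trace. The
relations need checking only on generators, where they are the compatibility of the two families of
injections. -/
theorem nonempty_thetaRep {m n : ℕ} (hm : 1 ≤ m) (hn : 1 ≤ n)
    (θ : Equiv.Perm (Fin m × Fin n)) : Nonempty (ThetaRep θ) := by
  obtain ⟨E, F, h⟩ := exists_nat_action θ hm hn
  have hE : ∀ i, Function.Injective fun l => E (i, l) := fun i a b hab =>
    congrArg Prod.snd (E.injective hab)
  have hF : ∀ i, Function.Injective fun l => F (i, l) := fun i a b hab =>
    congrArg Prod.snd (F.injective hab)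
  let gen : Fin m ⊕ Fin n → SeqOp :=
    Sum.elim (fun i => injIsometry (hE i)) (fun j => injIsometry (hF j))
  have hgen : ∀ x, star (gen x) * gen x = 1 := by
    rintro (i | j)
    · exact star_injIsometry_mul (hE i)
    · exact star_injIsometry_mul (hF j)
  refine ⟨{
    S := PresentedMonoid.lift gen ?_
    isometry := fun u => ?_
    defect_free_e := sum_injIsometry_mul_star E hE
    defect_free_f := sum_injIsometry_mul_star F hF }⟩
  · rintro _ _ ⟨i, j⟩
    simp only [map_mul, FreeMonoid.lift_eval_of]
    refine seqOp_ext fun k => ?_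
    change injIsometry (hE i) (injIsometry (hF j) (seqVec k)) =
      injIsometry (hF _) (injIsometry (hE _) (seqVec k))
    simp only [injIsometry_apply, h]
  · induction u using PresentedMonoid.inductionOn with
    | h w =>
      change star (FreeMonoid.lift gen w) * FreeMonoid.lift gen w = 1
      induction w using FreeMonoid.inductionOn' with
      | one => simp
      | of_mul x w ih =>
        rw [map_mul, FreeMonoid.lift_eval_of, star_mul, mul_assoc, ← mul_assoc (star (gen x)),
          hgen, one_mul, ih]

end

noncomputable section

/-! ### Words -/

namespace FTheta

variable {m n : ℕ} {θ : Equiv.Perm (Fin m × Fin n)}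

theorem induction {P : FTheta θ → Prop} (one : P 1) (e_mul : ∀ i u, P u → P (e i * u))
    (f_mul : ∀ j u, P u → P (f j * u)) (u : FTheta θ) : P u := by
  induction u using PresentedMonoid.inductionOn with
  | h w =>
    induction w using FreeMonoid.inductionOn' with
    | one => rw [map_one]; exact one
    | of_mul x w ih =>
      rw [map_mul]
      obtain i | j := x
      · exact e_mul i _ ih
      · exact f_mul j _ ih

theorem f_mul_e (i : Fin m) (j : Fin n) :
    (f j * e i : FTheta θ) = e (θ.symm (i, j)).1 * f (θ.symm (i, j)).2 := by
  rw [e_mul_f]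
  simp

/-- As θ is invertible, the commutation relation can be read backwards, which moves some `e` past
the letters `f` to the front. -/
theorem exists_e_mul (u : FTheta θ) (h : (deg u).1 ≠ 0) : ∃ i v, u = e i * v := by
  induction u using induction with
  | one => simp [deg_one] at h
  | e_mul i u _ => exact ⟨i, u, rfl⟩
  | f_mul j u ih =>
    rw [deg_mul, deg_f] at h
    obtain ⟨i, v, rfl⟩ := ih (by simpa using h)
    exact ⟨_, _, by rw [← mul_assoc, f_mul_e, mul_assoc]⟩

theorem exists_f_mul (u : FTheta θ) (h : (deg u).2 ≠ 0) : ∃ j v, u = f j * v := by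
  induction u using induction with
  | one => simp [deg_one] at h
  | f_mul i u _ => exact ⟨i, u, rfl⟩
  | e_mul j u ih =>
    rw [deg_mul, deg_e] at h
    obtain ⟨i, v, rfl⟩ := ih (by simpa using h)
    exact ⟨_, _, by rw [← mul_assoc, e_mul_f, mul_assoc]⟩

theorem eq_one_of_deg_eq_zero {u : FTheta θ} (h : deg u = 0) : u = 1 := by
  induction u using induction with
  | one => rfl
  | e_mul i u _ =>
    have := congrArg Prod.fst h
    simp [deg_mul, deg_e] at this
  | f_mul i u _ =>
    have := congrArg Prod.snd h
    simp [deg_mul, deg_f] at this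

end FTheta

/-- Compressing `∑ S k * star (S k) = 1` by `S j` writes 1 as a sum of positive elements whose j-th
term is already 1, so the other terms vanish. -/
theorem star_mul_eq_zero_of_sum_eq_one {A ι : Type*} [CStarAlgebra A] [PartialOrder A]
    [StarOrderedRing A] [Fintype ι] [DecidableEq ι] {S : ι → A} (hS : ∀ i, star (S i) * S i = 1)
    (h : ∑ i, S i * star (S i) = 1) {i j : ι} (hij : i ≠ j) : star (S i) * S j = 0 := by
  have h1 : ∑ k, star (star (S k) * S j) * (star (S k) * S j) = 1 := by
    calc _ = star (S j) * (∑ k, S k * star (S k)) * S j := by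
          rw [Finset.mul_sum, Finset.sum_mul]
          exact Finset.sum_congr rfl fun k _ => by rw [star_mul, star_star]; noncomm_ring
      _ = 1 := by rw [h, mul_one, hS]
  rw [← Finset.add_sum_erase _ _ (Finset.mem_univ j), hS, star_one, one_mul,
    add_eq_left, Finset.sum_eq_zero_iff_of_nonneg fun _ _ => star_mul_self_nonneg _] at h1
  exact (CStarRing.star_mul_self_eq_zero_iff _).1
    (h1 i (Finset.mem_erase.2 ⟨hij, Finset.mem_univ i⟩))

namespace OTheta

open FTheta

variable {m n : ℕ} {θ : Equiv.Perm (Fin m × Fin n)}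

theorem nontrivial (hm : 1 ≤ m) (hn : 1 ≤ n) (θ : Equiv.Perm (Fin m × Fin n)) :
    Nontrivial (OTheta θ) := by
  obtain ⟨π⟩ := nonempty_thetaRep hm hn θ
  refine ⟨1, 0, fun h => ?_⟩
  have := congrArg (rep π) h
  rw [map_one, map_zero] at this
  exact one_ne_zero this

theorem star_s_e_mul {i j : Fin m} (h : i ≠ j) :
    star (s (e i : FTheta θ)) * s (e j) = 0 :=
  star_mul_eq_zero_of_sum_eq_one (fun _ => star_s_mul_s _) defect_free_e h

theorem star_s_f_mul {i j : Fin n} (h : i ≠ j) :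
    star (s (f i : FTheta θ)) * s (f j) = 0 :=
  star_mul_eq_zero_of_sum_eq_one (fun _ => star_s_mul_s _) defect_free_f h

theorem star_s_mul_mul_s_mul (a b u v : FTheta θ) :
    star (s (a * u)) * s (b * v) = star (s u) * (star (s a) * s b) * s v := by
  rw [map_mul, map_mul, star_mul]
  noncomm_ring

/-- Words of the same degree have orthogonal ranges. -/
theorem star_s_mul_s_of_ne {u v : FTheta θ} (hd : deg u = deg v) (h : u ≠ v) :
    star (s u) * s v = 0 := by
  induction u using FTheta.induction generalizing v with
  | one => exact absurd (eq_one_of_deg_eq_zero (hd.symm.trans deg_one)).symm h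
  | e_mul i u ih =>
    obtain ⟨j, v, rfl⟩ := exists_e_mul v (by rw [← hd, deg_mul, deg_e]; simp)
    rw [star_s_mul_mul_s_mul]
    by_cases hij : i = j
    · subst hij
      rw [star_s_mul_s, mul_one]
      refine ih ?_ fun huv => h (by rw [huv])
      simpa [deg_mul, deg_e] using hd
    · rw [star_s_e_mul hij, mul_zero, zero_mul]
  | f_mul i u ih =>
    obtain ⟨j, v, rfl⟩ := exists_f_mul v (by rw [← hd, deg_mul, deg_f]; simp)
    rw [star_s_mul_mul_s_mul]
    by_cases hij : i = j
    · subst hij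
      rw [star_s_mul_s, mul_one]
      refine ih ?_ fun huv => h (by rw [huv])
      simpa [deg_mul, deg_f] using hd
    · rw [star_s_f_mul hij, mul_zero, zero_mul]

/-- Equality in the semigroup is detected in the algebra: distinct words of equal degree have
orthogonal ranges, and a common isometry would force 1 = 0. -/
theorem eq_of_s_eq [Nontrivial (OTheta θ)] {u v : FTheta θ} (hd : deg u = deg v)
    (h : s u = s v) : u = v := by
  by_contra hne
  have h1 := star_s_mul_s_of_ne hd hne
  rw [← h, star_s_mul_s] at h1
  exact one_ne_zero h1

-- Factoring off a first letter `g i` is unique, because the `g i` have orthogonal ranges and `s (g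
-- i)` can be cancelled. So words of degree `d + k` correspond to pairs of a letter and a word of
-- degree `k`, and the range projections multiply out accordingly.
open Classical in
theorem exists_words_succ [Nontrivial (OTheta θ)] {r : ℕ} (g : Fin r → FTheta θ) (d : ℕ × ℕ)
    (hd : ∀ i, deg (g i) = d) (hg : Function.Injective g)
    (hsum : ∑ i, s (g i) * star (s (g i)) = 1) {k : ℕ × ℕ}
    (hex : ∀ u, deg u = d + k → ∃ i v, u = g i * v) {W : Finset (FTheta θ)}
    (hW : ∀ u, u ∈ W ↔ deg u = k) (hW1 : ∑ u ∈ W, s u * star (s u) = 1) :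
    ∃ W' : Finset (FTheta θ), (∀ u, u ∈ W' ↔ deg u = d + k) ∧
      ∑ u ∈ W', s u * star (s u) = 1 ∧ W'.card = r * W.card := by
  have hinj : Set.InjOn (fun p : Fin r × FTheta θ => g p.1 * p.2)
      (Finset.univ ×ˢ W : Finset (Fin r × FTheta θ)) := by
    rintro ⟨i, u⟩ hu ⟨j, v⟩ hv huv
    simp only [Finset.coe_product, Finset.coe_univ, Set.mem_prod, Set.mem_univ, true_and,
      Finset.mem_coe, hW] at hu hv
    have h1 : s (g i * u) = s (g j * v) := congrArg s huv
    have hij : i = j := by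
      by_contra hij
      have h2 : star (s (g i * u)) * s (g j * v) = 0 := by
        rw [star_s_mul_mul_s_mul, star_s_mul_s_of_ne ((hd i).trans (hd j).symm)
          fun h => hij (hg h), mul_zero, zero_mul]
      rw [← h1, star_s_mul_s] at h2
      exact one_ne_zero h2
    subst hij
    refine Prod.ext rfl (eq_of_s_eq (hu.trans hv.symm) ?_)
    have h2 := congrArg (star (s (g i)) * ·) h1
    simpa [map_mul, ← mul_assoc, star_s_mul_s] using h2
  refine ⟨(Finset.univ ×ˢ W).image fun p => g p.1 * p.2, fun u => ?_, ?_, ?_⟩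
  · simp only [Finset.mem_image, Finset.mem_product, Finset.mem_univ, true_and, Prod.exists, hW]
    constructor
    · rintro ⟨i, v, hv, rfl⟩
      rw [deg_mul, hd, hv]
    · intro hu
      obtain ⟨i, v, rfl⟩ := hex u hu
      refine ⟨i, v, ?_, rfl⟩
      rw [deg_mul, hd] at hu
      exact add_left_cancel hu
  · rw [Finset.sum_image hinj, Finset.sum_product]
    rw [← hsum]
    refine Finset.sum_congr rfl fun i _ => ?_
    calc _ = s (g i) * (∑ u ∈ W, s u * star (s u)) * star (s (g i)) := by
          rw [Finset.mul_sum, Finset.sum_mul]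
          exact Finset.sum_congr rfl fun k _ => by rw [map_mul, star_mul]; noncomm_ring
      _ = _ := by rw [hW1, mul_one]
  · rw [Finset.card_image_of_injOn hinj, Finset.card_product, Finset.card_univ, Fintype.card_fin]

theorem e_injective [Nontrivial (OTheta θ)] : Function.Injective (e : Fin m → FTheta θ) := by
  intro i j hij
  by_contra h
  have h1 := star_s_e_mul (θ := θ) h
  rw [hij, star_s_mul_s] at h1
  exact one_ne_zero h1

theorem f_injective [Nontrivial (OTheta θ)] : Function.Injective (f : Fin n → FTheta θ) := by
  intro i j hij
  by_contra h
  have h1 := star_s_f_mul (θ := θ) h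
  rw [hij, star_s_mul_s] at h1
  exact one_ne_zero h1

theorem exists_words [Nontrivial (OTheta θ)] (p q : ℕ) :
    ∃ W : Finset (FTheta θ), (∀ u, u ∈ W ↔ deg u = (p, q)) ∧
      ∑ u ∈ W, s u * star (s u) = 1 ∧ W.card = m ^ p * n ^ q := by
  induction p with
  | zero =>
    induction q with
    | zero =>
      refine ⟨{1}, fun u => ?_, by simp, by simp⟩
      rw [Finset.mem_singleton]
      exact ⟨fun h => h ▸ deg_one, fun h => eq_one_of_deg_eq_zero h⟩
    | succ q ih =>
      obtain ⟨W, h1, h2, h3⟩ := ih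
      obtain ⟨W', h1', h2', h3'⟩ := exists_words_succ f (0, 1) deg_f f_injective defect_free_f
        (fun u hu => exists_f_mul u (by simp [hu])) h1 h2
      refine ⟨W', fun u => ?_, h2', by rw [h3', h3]; ring⟩
      rw [h1', Prod.mk_add_mk, add_comm 1 q, zero_add]
  | succ p ih =>
    obtain ⟨W, h1, h2, h3⟩ := ih
    obtain ⟨W', h1', h2', h3'⟩ := exists_words_succ e (1, 0) deg_e e_injective defect_free_e
      (fun u hu => exists_e_mul u (by simp [hu])) h1 h2
    refine ⟨W', fun u => ?_, h2', by rw [h3', h3]; ring⟩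
    rw [h1', Prod.mk_add_mk, add_comm 1 p, zero_add]

/-- The finite set of the words of degree `k`. -/
def words (θ : Equiv.Perm (Fin m × Fin n)) [Nontrivial (OTheta θ)] (k : ℕ × ℕ) :
    Finset (FTheta θ) := (exists_words k.1 k.2).choose

section Words

variable [Nontrivial (OTheta θ)]

theorem mem_words {k : ℕ × ℕ} {u : FTheta θ} : u ∈ words θ k ↔ deg u = k :=
  (exists_words k.1 k.2).choose_spec.1 u

theorem sum_words (k : ℕ × ℕ) : ∑ u ∈ words θ k, s u * star (s u) = 1 :=
  (exists_words k.1 k.2).choose_spec.2.1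

theorem card_words (k : ℕ × ℕ) : (words θ k).card = m ^ k.1 * n ^ k.2 :=
  (exists_words k.1 k.2).choose_spec.2.2

/-- Inserting `∑ s c * star (s c) = 1` raises both degrees by `k`. This gives the embeddings between
levels and lets words be compared at a common degree. -/
theorem s_mul_star_s_eq_sum (u v : FTheta θ) (k : ℕ × ℕ) :
    s u * star (s v) = ∑ c ∈ words θ k, s (u * c) * star (s (v * c)) := by
  calc s u * star (s v) = s u * (∑ c ∈ words θ k, s c * star (s c)) * star (s v) := by
        rw [sum_words, mul_one]
    _ = _ := by
        rw [Finset.mul_sum, Finset.sum_mul]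
        exact Finset.sum_congr rfl fun c _ => by simp only [map_mul, star_mul]; noncomm_ring

variable (θ) in
/-- The span of the matrix units of degree `k`. -/
def level (k : ℕ × ℕ) : Submodule ℂ (OTheta θ) :=
  Submodule.span ℂ {X | ∃ u ∈ words θ k, ∃ v ∈ words θ k, X = s u * star (s v)}

theorem mem_level {u v : FTheta θ} {k : ℕ × ℕ} (hu : deg u = k) (hv : deg v = k) :
    s u * star (s v) ∈ level θ k :=
  Submodule.subset_span ⟨u, mem_words.2 hu, v, mem_words.2 hv, rfl⟩

theorem level_mono {k l : ℕ × ℕ} (h : k ≤ l) : level θ k ≤ level θ l := by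
  obtain ⟨d, rfl⟩ := exists_add_of_le h
  refine Submodule.span_le.2 ?_
  rintro _ ⟨u, hu, v, hv, rfl⟩
  rw [s_mul_star_s_eq_sum u v d]
  refine Submodule.sum_mem _ fun c hc => mem_level ?_ ?_
  · rw [deg_mul, mem_words.1 hu, mem_words.1 hc]
  · rw [deg_mul, mem_words.1 hv, mem_words.1 hc]

end Words

/-! ### The algebra spanned by the `s_u s_v*` -/

variable (θ) in
/-- The linear span of the elements `s_u s_v*`. -/
def coreSpan : Submodule ℂ (OTheta θ) :=
  Submodule.span ℂ {X | ∃ u v : FTheta θ, X = s u * star (s v)}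

theorem mem_coreSpan (u v : FTheta θ) : s u * star (s v) ∈ coreSpan θ :=
  Submodule.subset_span ⟨u, v, rfl⟩

/-- Expand `star (s v)` and `s a` so that the words meeting in the middle, `v * c` and `a * d`, both
have degree `deg v + deg a`; their product is then 1 or 0. -/
theorem star_s_mul_s_mem [Nontrivial (OTheta θ)] (v a : FTheta θ) :
    star (s v) * s a ∈ coreSpan θ := by
  have h1 := s_mul_star_s_eq_sum 1 v (deg a)
  have h2 := s_mul_star_s_eq_sum a 1 (deg v)
  simp only [map_one, one_mul, mul_one, star_one] at h1 h2
  rw [h1, h2, Finset.sum_mul_sum]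
  refine Submodule.sum_mem _ fun c hc => Submodule.sum_mem _ fun d hd => ?_
  have e1 : s c * star (s (v * c)) * (s (a * d) * star (s d)) =
      s c * (star (s (v * c)) * s (a * d)) * star (s d) := by noncomm_ring
  rw [e1]
  by_cases h : v * c = a * d
  · rw [h, star_s_mul_s, mul_one]
    exact mem_coreSpan c d
  · rw [star_s_mul_s_of_ne _ h, mul_zero, zero_mul]
    · exact Submodule.zero_mem _
    · rw [deg_mul, deg_mul, mem_words.1 hc, mem_words.1 hd, add_comm]

theorem s_mul_mem_coreSpan (u v : FTheta θ) {X : OTheta θ} (hX : X ∈ coreSpan θ) :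
    s u * X * star (s v) ∈ coreSpan θ := by
  induction hX using Submodule.span_induction with
  | mem X h =>
    obtain ⟨a, b, rfl⟩ := h
    have := mem_coreSpan (u * a) (v * b)
    rw [map_mul, map_mul, star_mul] at this
    simpa only [mul_assoc] using this
  | zero => rw [mul_zero, zero_mul]; exact Submodule.zero_mem _
  | add X Y _ _ hX hY => rw [mul_add, add_mul]; exact Submodule.add_mem _ hX hY
  | smul c X _ hX => rw [mul_smul_comm, smul_mul_assoc]; exact Submodule.smul_mem _ c hX

theorem mul_mem_coreSpan [Nontrivial (OTheta θ)] {X Y : OTheta θ} (hX : X ∈ coreSpan θ)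
    (hY : Y ∈ coreSpan θ) : X * Y ∈ coreSpan θ := by
  induction hX, hY using Submodule.span_induction₂ with
  | mem_mem X Y hX hY =>
    obtain ⟨u, v, rfl⟩ := hX
    obtain ⟨a, b, rfl⟩ := hY
    have := s_mul_mem_coreSpan u b (star_s_mul_s_mem v a)
    simpa only [mul_assoc] using this
  | zero_left Y _ => rw [zero_mul]; exact Submodule.zero_mem _
  | zero_right X _ => rw [mul_zero]; exact Submodule.zero_mem _
  | add_left X Y Z _ _ _ h1 h2 => rw [add_mul]; exact Submodule.add_mem _ h1 h2
  | add_right X Y Z _ _ _ h1 h2 => rw [mul_add]; exact Submodule.add_mem _ h1 h2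
  | smul_left c X Y _ _ h => rw [smul_mul_assoc]; exact Submodule.smul_mem _ c h
  | smul_right c X Y _ _ h => rw [mul_smul_comm]; exact Submodule.smul_mem _ c h

theorem star_mem_coreSpan {X : OTheta θ} (hX : X ∈ coreSpan θ) : star X ∈ coreSpan θ := by
  induction hX using Submodule.span_induction with
  | mem X h =>
    obtain ⟨u, v, rfl⟩ := h
    rw [star_mul, star_star]
    exact mem_coreSpan v u
  | zero => rw [star_zero]; exact Submodule.zero_mem _
  | add X Y _ _ hX hY => rw [star_add]; exact Submodule.add_mem _ hX hY
  | smul c X _ hX => rw [star_smul]; exact Submodule.smul_mem _ _ hX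

theorem one_mem_coreSpan : (1 : OTheta θ) ∈ coreSpan θ := by
  simpa using mem_coreSpan (1 : FTheta θ) 1

variable (θ) in
/-- The *-algebra spanned by the elements `s_u s_v*`. -/
def coreAlgebra [Nontrivial (OTheta θ)] : StarSubalgebra ℂ (OTheta θ) where
  carrier := coreSpan θ
  mul_mem' := mul_mem_coreSpan
  one_mem' := one_mem_coreSpan
  add_mem' := Submodule.add_mem _
  zero_mem' := Submodule.zero_mem _
  algebraMap_mem' r := by
    rw [Algebra.algebraMap_eq_smul_one]
    exact Submodule.smul_mem _ _ one_mem_coreSpan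
  star_mem' := star_mem_coreSpan

theorem s_mem_coreSpan (u : FTheta θ) : s u ∈ coreSpan θ := by
  simpa using mem_coreSpan u 1

/-- The image of the core in the product of all representations is a *-algebra containing the
generators, hence contains the adjoined algebra whose closure defines `OTheta θ`. -/
theorem dense_coreAlgebra [Nontrivial (OTheta θ)] : Dense (coreAlgebra θ : Set (OTheta θ)) := by
  intro x
  have hind : Topology.IsInducing (incl (θ := θ)) := Topology.IsInducing.subtypeVal
  rw [hind.closure_eq_preimage_closure_image]
  have h1 : StarAlgebra.adjoin ℂ (Set.range (ThetaRep.univS (θ := θ))) ≤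
      (coreAlgebra θ).map incl := by
    refine StarAlgebra.adjoin_le ?_
    rintro _ ⟨u, rfl⟩
    exact ⟨s u, s_mem_coreSpan u, rfl⟩
  have h2 : incl x ∈ universalSubalgebra θ := x.2
  exact closure_mono (fun y hy => h1 hy) h2

end OTheta

end

noncomputable section

/-! ### The gauge action and its spectral subspaces -/

namespace OTheta

open FTheta

variable {m n : ℕ} {θ : Equiv.Perm (Fin m × Fin n)}

/-- The character `t ↦ t^g` of the torus, `g ∈ ℤ²`. -/
def torusChar (g : ℤ × ℤ) (t : Circle × Circle) : Circle := t.1 ^ g.1 * t.2 ^ g.2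

theorem torusChar_zero (t : Circle × Circle) : torusChar 0 t = 1 := by simp [torusChar]

theorem torusChar_add (g h : ℤ × ℤ) (t : Circle × Circle) :
    torusChar (g + h) t = torusChar g t * torusChar h t := by
  simp only [torusChar, Prod.fst_add, Prod.snd_add, zpow_add]
  exact mul_mul_mul_comm _ _ _ _

theorem torusChar_neg (g : ℤ × ℤ) (t : Circle × Circle) :
    torusChar (-g) t = (torusChar g t)⁻¹ := by
  simp [torusChar, zpow_neg, mul_comm]

theorem exists_zpow_ne_one {k : ℤ} (hk : k ≠ 0) : ∃ z : Circle, z ^ k ≠ 1 := by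
  refine ⟨Circle.exp (Real.pi / k), fun h => ?_⟩
  rw [← Circle.exp_zsmul] at h
  have e : k • (Real.pi / k) = Real.pi := by
    rw [zsmul_eq_mul]
    field_simp
  rw [e] at h
  have := congrArg (fun z : Circle => (z : ℂ)) h
  simp only [Circle.coe_exp, Complex.exp_pi_mul_I, Circle.coe_one] at this
  norm_num at this

theorem exists_torusChar_ne {g h : ℤ × ℤ} (hgh : g ≠ h) : ∃ t, torusChar g t ≠ torusChar h t := by
  obtain ⟨t, ht⟩ : ∃ t, torusChar (g - h) t ≠ 1 := by
    by_cases h1 : g.1 = h.1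
    · have h2 : g.2 - h.2 ≠ 0 := fun h2 => hgh (Prod.ext h1 (sub_eq_zero.1 h2))
      obtain ⟨z, hz⟩ := exists_zpow_ne_one h2
      exact ⟨(1, z), by simpa [torusChar] using hz⟩
    · obtain ⟨z, hz⟩ := exists_zpow_ne_one (sub_ne_zero.2 h1)
      exact ⟨(z, 1), by simpa [torusChar] using hz⟩
  refine ⟨t, fun h' => ht ?_⟩
  rw [sub_eq_add_neg, torusChar_add, torusChar_neg, h', mul_inv_cancel]

variable (θ) in
/-- The spectral subspace `{X | γ_t(X) = t^g X}`, `g ∈ ℤ²`, of the gauge action. -/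
def spectral (g : ℤ × ℤ) : Submodule ℂ (OTheta θ) where
  carrier := {X | ∀ t, gauge t X = (torusChar g t : ℂ) • X}
  add_mem' hX hY t := by rw [map_add, hX t, hY t, smul_add]
  zero_mem' t := by simp
  smul_mem' c X hX t := by rw [map_smul, hX t, smul_comm]

theorem mul_mem_spectral {g h : ℤ × ℤ} {X Y : OTheta θ} (hX : X ∈ spectral θ g)
    (hY : Y ∈ spectral θ h) : X * Y ∈ spectral θ (g + h) := fun t => by
  rw [map_mul, hX t, hY t, torusChar_add, smul_mul_smul_comm, Circle.coe_mul]

theorem star_mem_spectral {g : ℤ × ℤ} {X : OTheta θ} (hX : X ∈ spectral θ g) :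
    star X ∈ spectral θ (-g) := fun t => by
  rw [map_star, hX t, torusChar_neg, star_smul, Circle.coe_inv_eq_conj]
  rfl

theorem mem_fixedAlgebra_iff {X : OTheta θ} : X ∈ fixedAlgebra θ ↔ X ∈ spectral θ 0 := by
  refine forall_congr' fun t => ?_
  rw [torusChar_zero, Circle.coe_one, one_smul]

/-- The difference of the degrees of two words. -/
def degDiff (u v : FTheta θ) : ℤ × ℤ :=
  (((deg u).1 : ℤ) - (deg v).1, ((deg u).2 : ℤ) - (deg v).2)

theorem s_mem_spectral (u : FTheta θ) : s u ∈ spectral θ (degDiff u 1) := fun t => by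
  rw [gauge_s]
  simp [ThetaRep.phase, torusChar, degDiff, deg_one]

theorem s_mul_star_s_mem_spectral (u v : FTheta θ) :
    s u * star (s v) ∈ spectral θ (degDiff u v) := by
  convert mul_mem_spectral (s_mem_spectral u) (star_mem_spectral (s_mem_spectral v)) using 1
  simp [degDiff, deg_one, sub_eq_add_neg]

theorem norm_gauge_le (t : Circle × Circle) (X : OTheta θ) : ‖gauge t X‖ ≤ ‖X‖ :=
  NonUnitalStarAlgHom.norm_apply_le _ X

/-- On the core the orbit maps are trigonometric polynomials; since each γ_t is contractive,
approximating X in norm approximates its orbit map uniformly. -/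
theorem continuous_gauge [Nontrivial (OTheta θ)] (X : OTheta θ) :
    Continuous fun t => gauge t X := by
  have hcore : ∀ Y ∈ coreSpan θ, Continuous fun t => gauge t Y := by
    intro Y hY
    induction hY using Submodule.span_induction with
    | mem Y h =>
      obtain ⟨u, v, rfl⟩ := h
      simp only [s_mul_star_s_mem_spectral u v _]
      have : Continuous (torusChar (degDiff u v)) :=
        (continuous_fst.zpow _).mul (continuous_snd.zpow _)
      exact ((by fun_prop : Continuous ((↑) : Circle → ℂ)).comp this).smul continuous_const
    | zero => simpa using continuous_const
    | add Y Z _ _ hY hZ => simp only [map_add]; exact hY.add hZ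
    | smul c Y _ hY => simp only [map_smul]; exact hY.const_smul c
  refine continuous_of_uniform_approx_of_continuous fun U hU => ?_
  obtain ⟨ε, hε, hU⟩ := Metric.mem_uniformity_dist.1 hU
  obtain ⟨Y, hY, hXY⟩ := Metric.dense_iff.1 dense_coreAlgebra X ε hε
  refine ⟨fun t => gauge t Y, hcore Y hXY, fun t => hU ?_⟩
  rw [dist_eq_norm, ← map_sub]
  refine (norm_gauge_le t _).trans_lt ?_
  rwa [← dist_eq_norm, dist_comm]

instance : MeasureTheory.IsProbabilityMeasure torusMeasure := by
  unfold torusMeasure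
  infer_instance

theorem continuous_torusPoint : Continuous torusPoint := by
  unfold torusPoint
  exact (AddCircle.continuous_toCircle.comp continuous_fst).prodMk
    (AddCircle.continuous_toCircle.comp continuous_snd)

theorem torusPoint_surjective : Function.Surjective torusPoint := by
  intro r
  obtain ⟨a, ha⟩ := (AddCircle.homeomorphCircle (T := 1) one_ne_zero).surjective r.1
  obtain ⟨b, hb⟩ := (AddCircle.homeomorphCircle (T := 1) one_ne_zero).surjective r.2
  rw [AddCircle.homeomorphCircle_apply] at ha hb
  exact ⟨(a, b), Prod.ext ha hb⟩

theorem integrable_gauge [Nontrivial (OTheta θ)] (X : OTheta θ) :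
    MeasureTheory.Integrable (fun t => gauge (torusPoint t) X) torusMeasure :=
  ((continuous_gauge X).comp continuous_torusPoint).integrable_of_hasCompactSupport
    (HasCompactSupport.of_compactSpace _)

theorem gaugeAverage_add [Nontrivial (OTheta θ)] (X Y : OTheta θ) :
    gaugeAverage (X + Y) = gaugeAverage X + gaugeAverage Y := by
  simp only [gaugeAverage, map_add]
  exact MeasureTheory.integral_add (integrable_gauge X) (integrable_gauge Y)

theorem gaugeAverage_smul (c : ℂ) (X : OTheta θ) :
    gaugeAverage (c • X) = c • gaugeAverage X := by
  simp only [gaugeAverage, map_smul]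
  exact MeasureTheory.integral_smul c _

theorem norm_gaugeAverage_le (X : OTheta θ) : ‖gaugeAverage X‖ ≤ ‖X‖ := by
  have h := MeasureTheory.norm_integral_le_of_norm_le_const (μ := torusMeasure)
    (f := fun t => gauge (torusPoint t) X) (C := ‖X‖)
    (Filter.Eventually.of_forall fun t => norm_gauge_le _ X)
  simpa [gaugeAverage] using h

theorem gaugeAverage_nonneg {X : OTheta θ} (hX : 0 ≤ X) : 0 ≤ gaugeAverage X :=
  MeasureTheory.integral_nonneg fun t => map_nonneg (gauge (torusPoint t)) hX

theorem gaugeAverage_of_mem_fixedAlgebra {X : OTheta θ} (hX : X ∈ fixedAlgebra θ) :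
    gaugeAverage X = X := by
  have h : ∀ t, gauge (torusPoint t) X = X := fun t => hX _
  simp [gaugeAverage, h]

theorem gaugeAverage_gauge (r : Circle × Circle) (X : OTheta θ) :
    gaugeAverage (gauge r X) = gaugeAverage X := by
  obtain ⟨a, rfl⟩ := torusPoint_surjective r
  have h : ∀ t, gauge (torusPoint t) (gauge (torusPoint a) X) = gauge (torusPoint (t + a)) X := by
    intro t
    rw [gauge_gauge]
    simp [torusPoint, AddCircle.toCircle_add]
  simp_rw [gaugeAverage, h]
  have : torusMeasure.IsAddRightInvariant := by unfold torusMeasure; infer_instance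
  exact MeasureTheory.integral_add_right_eq_self (μ := torusMeasure)
    (fun t : UnitAddCircle × UnitAddCircle => gauge (torusPoint t) X) a

section Average

variable [Nontrivial (OTheta θ)]

/-- Invariance of the average gives (t^g - 1) Φ(X) = 0 for all t, and some t has t^g ≠ 1. -/
theorem gaugeAverage_of_mem_spectral {g : ℤ × ℤ} (hg : g ≠ 0) {X : OTheta θ}
    (hX : X ∈ spectral θ g) : gaugeAverage X = 0 := by
  obtain ⟨t, ht⟩ := exists_torusChar_ne hg
  have h := gaugeAverage_gauge t X
  rw [hX t, gaugeAverage_smul] at h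
  have h1 : ((torusChar g t : ℂ) - 1) • gaugeAverage X = 0 := by
    rw [sub_smul, h, one_smul, sub_self]
  refine (smul_eq_zero.1 h1).resolve_left fun h2 => ht ?_
  rw [torusChar_zero]
  exact Circle.ext (by rw [sub_eq_zero.1 h2, Circle.coe_one])

variable (θ) in
/-- The expectation `Φ` as a linear map. -/
def PhiLin : OTheta θ →ₗ[ℂ] fixedAlgebra θ where
  toFun := Phi
  map_add' X Y := Subtype.ext (gaugeAverage_add X Y)
  map_smul' c X := Subtype.ext (gaugeAverage_smul c X)

/-- Averaging fixes `s u * star (s v)` if the degrees agree and kills it otherwise. The finitely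
many survivors fit into the level of the supremum of their degrees. -/
theorem exists_mem_level_of_mem_coreSpan {X : OTheta θ} (hX : X ∈ coreSpan θ) :
    ∃ k : ℕ × ℕ, gaugeAverage X ∈ level θ k := by
  induction hX using Submodule.span_induction with
  | mem X h =>
    obtain ⟨u, v, rfl⟩ := h
    by_cases hd : degDiff u v = 0
    · refine ⟨deg u, ?_⟩
      rw [gaugeAverage_of_mem_fixedAlgebra]
      · refine mem_level rfl ?_
        have h1 := congrArg Prod.fst hd
        have h2 := congrArg Prod.snd hd
        simp only [degDiff, Prod.fst_zero, Prod.snd_zero] at h1 h2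
        exact Prod.ext (by omega) (by omega)
      · rw [mem_fixedAlgebra_iff, ← hd]
        exact s_mul_star_s_mem_spectral u v
    · refine ⟨0, ?_⟩
      rw [gaugeAverage_of_mem_spectral hd (s_mul_star_s_mem_spectral u v)]
      exact Submodule.zero_mem _
  | zero =>
    refine ⟨0, ?_⟩
    rw [gaugeAverage_of_mem_fixedAlgebra (zero_mem _)]
    exact Submodule.zero_mem _
  | add X Y _ _ hX hY =>
    obtain ⟨k, hk⟩ := hX
    obtain ⟨l, hl⟩ := hY
    refine ⟨k ⊔ l, ?_⟩
    rw [gaugeAverage_add]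
    exact Submodule.add_mem _ (level_mono le_sup_left hk) (level_mono le_sup_right hl)
  | smul c X _ hX =>
    obtain ⟨k, hk⟩ := hX
    exact ⟨k, by rw [gaugeAverage_smul]; exact Submodule.smul_mem _ c hk⟩

theorem level_le_fixedAlgebra {k : ℕ × ℕ} {X : OTheta θ} (hX : X ∈ level θ k) :
    X ∈ fixedAlgebra θ := by
  rw [mem_fixedAlgebra_iff]
  refine (Submodule.span_le.2 ?_ : level θ k ≤ spectral θ 0) hX
  rintro _ ⟨u, hu, v, hv, rfl⟩
  have : degDiff u v = 0 := by simp [degDiff, mem_words.1 hu, mem_words.1 hv]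
  rw [← this]
  exact s_mul_star_s_mem_spectral u v

/-- The matrix algebras are dense in the fixed point algebra. -/
theorem exists_level_approx {X : OTheta θ} (hX : X ∈ fixedAlgebra θ) {ε : ℝ} (hε : 0 < ε) :
    ∃ k, ∃ Y ∈ level θ k, ‖X - Y‖ < ε := by
  obtain ⟨Y, hXY, hY⟩ := Metric.dense_iff.1 dense_coreAlgebra X ε hε
  obtain ⟨k, hk⟩ := exists_mem_level_of_mem_coreSpan hY
  refine ⟨k, _, hk, ?_⟩
  have h := norm_gaugeAverage_le (X - Y)
  rw [sub_eq_add_neg, ← neg_one_smul ℂ Y, gaugeAverage_add, gaugeAverage_smul, neg_one_smul,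
    neg_one_smul, ← sub_eq_add_neg, ← sub_eq_add_neg, gaugeAverage_of_mem_fixedAlgebra hX] at h
  refine h.trans_lt ?_
  rwa [← dist_eq_norm, dist_comm]

end Average

end OTheta

end

noncomputable section

/-! ### The trace on the fixed point algebra -/

namespace OTheta

open FTheta Filter Topology

variable {m n : ℕ} {θ : Equiv.Perm (Fin m × Fin n)} [Nontrivial (OTheta θ)]

theorem words_card_ne_zero (k : ℕ × ℕ) : ((words θ k).card : ℂ) ≠ 0 := by
  rw [Nat.cast_ne_zero, Finset.card_ne_zero, Finset.nonempty_iff_ne_empty]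
  intro h
  have h1 := sum_words (θ := θ) k
  rw [h, Finset.sum_empty] at h1
  exact zero_ne_one h1

open Classical in
omit [Nontrivial (OTheta θ)] in
theorem unit_mul_unit {u v a b : FTheta θ} (h : deg v = deg a) :
    s u * star (s v) * (s a * star (s b)) = if v = a then s u * star (s b) else 0 := by
  have e : s u * star (s v) * (s a * star (s b)) = s u * (star (s v) * s a) * star (s b) := by
    noncomm_ring
  rw [e]
  split_ifs with hva
  · rw [hva, star_s_mul_s, mul_one]
  · rw [star_s_mul_s_of_ne h hva, mul_zero, zero_mul]

theorem unit_mem_fixedAlgebra {u v : FTheta θ} (h : deg u = deg v) :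
    s u * star (s v) ∈ fixedAlgebra θ :=
  level_le_fixedAlgebra (mem_level (k := deg v) h rfl)

theorem mem_closure_levels (X : fixedAlgebra θ) :
    (X : OTheta θ) ∈ closure (⋃ k, (level θ k : Set (OTheta θ))) := by
  refine Metric.mem_closure_iff.2 fun ε hε => ?_
  obtain ⟨k, Y, hY, h⟩ := exists_level_approx X.2 hε
  exact ⟨Y, Set.mem_iUnion.2 ⟨k, hY⟩, by rwa [dist_eq_norm]⟩

/-- A unital functional that is tracial on the fixed point algebra. -/
structure IsFixedTrace (φ : OTheta θ →ₗ[ℂ] ℂ) : Prop where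
  map_one : φ 1 = 1
  trace : ∀ X ∈ fixedAlgebra θ, ∀ Y ∈ fixedAlgebra θ, φ (X * Y) = φ (Y * X)

/-- s_u s_v* equals (s_u s_u*)(s_u s_v*), while the product in the other order is 0. -/
theorem IsFixedTrace.apply_of_ne {φ : OTheta θ →ₗ[ℂ] ℂ} (h : IsFixedTrace φ) {u v : FTheta θ}
    (hd : deg u = deg v) (huv : u ≠ v) : φ (s u * star (s v)) = 0 := by
  have h1 := h.trace _ (unit_mem_fixedAlgebra (θ := θ) (u := u) rfl) _ (unit_mem_fixedAlgebra hd)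
  rwa [unit_mul_unit rfl, if_pos rfl, unit_mul_unit hd.symm, if_neg huv.symm, map_zero] at h1

/-- The trace property applied to s_u s_v* and s_v s_u* shows that all diagonal units of one degree
have the same value, and they sum to 1. -/
theorem IsFixedTrace.apply_self {φ : OTheta θ →ₗ[ℂ] ℂ} (h : IsFixedTrace φ) (u : FTheta θ) :
    ((words θ (deg u)).card : ℂ) * φ (s u * star (s u)) = 1 := by
  have h1 : ∀ v ∈ words θ (deg u), φ (s v * star (s v)) = φ (s u * star (s u)) := by
    intro v hv
    have hd := mem_words.1 hv
    have h2 := h.trace _ (unit_mem_fixedAlgebra hd) _ (unit_mem_fixedAlgebra hd.symm)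
    rwa [unit_mul_unit rfl, if_pos rfl, unit_mul_unit rfl, if_pos rfl] at h2
  rw [← nsmul_eq_mul, ← Finset.sum_const, ← Finset.sum_congr rfl h1, ← map_sum, sum_words,
    h.map_one]

theorem IsFixedTrace.eq_on_level {φ ψ : OTheta θ →ₗ[ℂ] ℂ} (hφ : IsFixedTrace φ)
    (hψ : IsFixedTrace ψ) {k : ℕ × ℕ} {X : OTheta θ} (hX : X ∈ level θ k) : φ X = ψ X := by
  refine LinearMap.eqOn_span (f := φ) (g := ψ) ?_ hX
  rintro _ ⟨u, hu, v, hv, rfl⟩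
  have hd : deg u = deg v := (mem_words.1 hu).trans (mem_words.1 hv).symm
  by_cases huv : u = v
  · subst huv
    exact mul_left_cancel₀ (words_card_ne_zero (deg u))
      ((hφ.apply_self u).trans (hψ.apply_self u).symm)
  · rw [hφ.apply_of_ne hd huv, hψ.apply_of_ne hd huv]

omit [Nontrivial (OTheta θ)] in
/-- Positive elements of the fixed point algebra have square roots there. -/
theorem exists_sqrt_mem_fixedAlgebra {X : OTheta θ} (hX : X ∈ fixedAlgebra θ) (h0 : 0 ≤ X) :
    ∃ b ∈ fixedAlgebra θ, star b * b = X := by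
  have hs : IsSelfAdjoint (CFC.sqrt X) := (CFC.sqrt_nonneg X).isSelfAdjoint
  refine ⟨CFC.sqrt X, fun t => ?_, by rw [hs.star_eq, CFC.sqrt_mul_sqrt_self X h0]⟩
  -- γ_t of the square root is again a positive square root of X, so uniqueness makes the root gauge
  -- invariant.
  refine (CFC.sqrt_unique ?_ (map_nonneg (gauge t) (CFC.sqrt_nonneg X))).symm
  rw [← map_mul, CFC.sqrt_mul_sqrt_self X h0, hX t]

/-! ### The state `τ ∘ Φ` and uniqueness of the trace -/

section State

variable {τ : fixedAlgebra θ →ₗ[ℂ] ℂ}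

-- `IsTracialState` gives positivity only on `star b * b` with `b` in 𝔉, whereas positivity of Φ(X)
-- is known in the ambient algebra; a square root inside 𝔉 bridges the two.
omit [Nontrivial (OTheta θ)] in
theorem trace_nonneg (hτ : IsTracialState τ) {X : fixedAlgebra θ} (hX : 0 ≤ (X : OTheta θ)) :
    0 ≤ τ X := by
  obtain ⟨b, hb, h⟩ := exists_sqrt_mem_fixedAlgebra X.2 hX
  have e : X = star (⟨b, hb⟩ : fixedAlgebra θ) * ⟨b, hb⟩ := Subtype.ext h.symm
  rw [e]
  exact hτ.nonneg _

/-- The state `ω = τ ∘ Φ`. -/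
def stateOf (hτ : IsTracialState τ) : OTheta θ →ₚ[ℂ] ℂ :=
  PositiveLinearMap.mk₀ (τ ∘ₗ PhiLin θ) fun _ hX => trace_nonneg hτ (gaugeAverage_nonneg hX)

theorem stateOf_apply (hτ : IsTracialState τ) (X : OTheta θ) : stateOf hτ X = τ (Phi X) := rfl

theorem stateOf_apply_fixed (hτ : IsTracialState τ) (X : fixedAlgebra θ) :
    stateOf hτ (X : OTheta θ) = τ X := by
  rw [stateOf_apply]
  exact congrArg τ (Subtype.ext (gaugeAverage_of_mem_fixedAlgebra X.2))

theorem stateOf_one (hτ : IsTracialState τ) : stateOf hτ 1 = 1 :=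
  (stateOf_apply_fixed hτ 1).trans hτ.map_one

theorem isFixedTrace_stateOf (hτ : IsTracialState τ) :
    IsFixedTrace (stateOf hτ).toLinearMap where
  map_one := stateOf_one hτ
  trace X hX Y hY :=
    (stateOf_apply_fixed hτ (⟨X, hX⟩ * ⟨Y, hY⟩)).trans
      ((hτ.trace _ _).trans (stateOf_apply_fixed hτ (⟨Y, hY⟩ * ⟨X, hX⟩)).symm)

/-- Both traces are restrictions of positive, hence continuous, functionals on `OTheta θ`, and these
agree on the dense union of the levels. -/
theorem tracialState_unique {τ' : fixedAlgebra θ →ₗ[ℂ] ℂ} (hτ : IsTracialState τ)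
    (hτ' : IsTracialState τ') : τ = τ' := by
  ext X
  rw [← stateOf_apply_fixed hτ, ← stateOf_apply_fixed hτ']
  refine Set.EqOn.closure ?_ (map_continuous (stateOf hτ)) (map_continuous (stateOf hτ'))
    (mem_closure_levels X)
  intro Y hY
  obtain ⟨k, hk⟩ := Set.mem_iUnion.1 hY
  exact (isFixedTrace_stateOf hτ).eq_on_level (isFixedTrace_stateOf hτ') hk

end State

/-! ### Existence of the trace -/

omit [Nontrivial (OTheta θ)] in
theorem norm_s_le (u : FTheta θ) : ‖(s u : OTheta θ)‖ ≤ 1 := by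
  rcases subsingleton_or_nontrivial (OTheta θ)
  · rw [Subsingleton.elim (s u) 0, norm_zero]; exact zero_le_one
  · have h : ‖(s u : OTheta θ)‖ * ‖(s u : OTheta θ)‖ = 1 := by
      rw [← CStarRing.norm_star_mul_self, star_s_mul_s, norm_one]
    nlinarith [norm_nonneg (s u : OTheta θ)]

/-- The average of `φ(s_u* X s_u)` over the words `u` of degree `k`. -/
def wordAverage (φ : OTheta θ →ₗ[ℂ] ℂ) (k : ℕ × ℕ) : OTheta θ →ₗ[ℂ] ℂ where
  toFun X := ((words θ k).card : ℂ)⁻¹ * ∑ u ∈ words θ k, φ (star (s u) * X * s u)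
  map_add' X Y := by
    simp only [mul_add, add_mul, map_add, Finset.sum_add_distrib]
  map_smul' c X := by
    simp only [mul_smul_comm, smul_mul_assoc, map_smul, ← Finset.smul_sum, RingHom.id_apply]

theorem wordAverage_apply (φ : OTheta θ →ₗ[ℂ] ℂ) (k : ℕ × ℕ) (X : OTheta θ) :
    wordAverage φ k X =
      ((words θ k).card : ℂ)⁻¹ * ∑ u ∈ words θ k, φ (star (s u) * X * s u) := rfl

theorem wordAverage_one {φ : OTheta θ →ₗ[ℂ] ℂ} (hφ : φ 1 = 1) (k : ℕ × ℕ) :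
    wordAverage φ k 1 = 1 := by
  simp only [wordAverage_apply, mul_one, star_s_mul_s, hφ, Finset.sum_const, nsmul_eq_mul]
  exact inv_mul_cancel₀ (words_card_ne_zero k)

theorem wordAverage_nonneg {φ : OTheta θ →ₗ[ℂ] ℂ} (hφ : ∀ X, 0 ≤ φ (star X * X)) (k : ℕ × ℕ)
    (X : OTheta θ) : 0 ≤ wordAverage φ k (star X * X) := by
  refine mul_nonneg ?_ (Finset.sum_nonneg fun u _ => ?_)
  · rw [inv_nonneg]
    exact Nat.cast_nonneg _
  · have e : star (s u) * (star X * X) * s u = star (X * s u) * (X * s u) := by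
      rw [star_mul]; noncomm_ring
    rw [e]
    exact hφ _

theorem norm_wordAverage_le {φ : OTheta θ →ₗ[ℂ] ℂ} (hφ : ∀ X, ‖φ X‖ ≤ ‖X‖) (k : ℕ × ℕ)
    (X : OTheta θ) : ‖wordAverage φ k X‖ ≤ ‖X‖ := by
  rw [wordAverage_apply, norm_mul, norm_inv, Complex.norm_natCast]
  have hpos : (0 : ℝ) < (words θ k).card := by
    have := words_card_ne_zero (θ := θ) k
    exact_mod_cast Nat.pos_of_ne_zero (by exact_mod_cast this)
  rw [inv_mul_le_iff₀ hpos, ← nsmul_eq_mul, ← Finset.sum_const]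
  refine (norm_sum_le _ _).trans (Finset.sum_le_sum fun u _ => (hφ _).trans ?_)
  calc ‖star (s u) * X * s u‖ ≤ ‖star (s u : OTheta θ)‖ * ‖X‖ * ‖(s u : OTheta θ)‖ :=
        (norm_mul_le _ _).trans (mul_le_mul_of_nonneg_right (norm_mul_le _ _) (norm_nonneg _))
    _ ≤ 1 * ‖X‖ * 1 := by
        rw [norm_star]
        gcongr <;> exact norm_s_le u
    _ = ‖X‖ := by ring

-- Only the word w = u contributes. The value does not depend on φ: on level `k` the average is the
-- normalized matrix trace.
open Classical in
theorem wordAverage_unit {φ : OTheta θ →ₗ[ℂ] ℂ} (hφ : φ 1 = 1) {k : ℕ × ℕ} {u v : FTheta θ}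
    (hu : deg u = k) (hv : deg v = k) :
    wordAverage φ k (s u * star (s v)) = if u = v then ((words θ k).card : ℂ)⁻¹ else 0 := by
  rw [wordAverage_apply, Finset.sum_eq_single u]
  · have e : star (s u) * (s u * star (s v)) * s u =
        (star (s u) * s u) * (star (s v) * s u : OTheta θ) := by noncomm_ring
    rw [e, star_s_mul_s, one_mul]
    split_ifs with h
    · rw [h, star_s_mul_s, hφ, mul_one]
    · rw [star_s_mul_s_of_ne (hv.trans hu.symm) (Ne.symm h), map_zero, mul_zero]
  · intro w hw hne
    have e : star (s w) * (s u * star (s v)) * s w =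
        (star (s w) * s u) * (star (s v) * s w : OTheta θ) := by noncomm_ring
    rw [e, star_s_mul_s_of_ne ((mem_words.1 hw).trans hu.symm) hne, zero_mul, map_zero]
  · intro h
    exact absurd (mem_words.2 hu) h

theorem wordAverage_trace {φ : OTheta θ →ₗ[ℂ] ℂ} (hφ : φ 1 = 1) {k : ℕ × ℕ} {X Y : OTheta θ}
    (hX : X ∈ level θ k) (hY : Y ∈ level θ k) :
    wordAverage φ k (X * Y) = wordAverage φ k (Y * X) := by
  induction hX, hY using Submodule.span_induction₂ with
  | mem_mem X Y hX hY =>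
    classical
    obtain ⟨u, hu, v, hv, rfl⟩ := hX
    obtain ⟨a, ha, b, hb, rfl⟩ := hY
    rw [mem_words] at hu hv ha hb
    rw [unit_mul_unit (hv.trans ha.symm), unit_mul_unit (hb.trans hu.symm)]
    by_cases h1 : v = a <;> by_cases h2 : b = u
    · subst h1 h2
      rw [if_pos rfl, if_pos rfl, wordAverage_unit hφ hb hb, wordAverage_unit hφ hv hv, if_pos rfl,
        if_pos rfl]
    · rw [if_pos h1, if_neg h2, wordAverage_unit hφ hu hb, if_neg (Ne.symm h2), map_zero]
    · rw [if_neg h1, if_pos h2, wordAverage_unit hφ ha hv, if_neg (Ne.symm h1), map_zero]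
    · rw [if_neg h1, if_neg h2]
  | zero_left Y _ => rw [zero_mul, mul_zero]
  | zero_right X _ => rw [zero_mul, mul_zero]
  | add_left X Y Z _ _ _ h1 h2 => rw [add_mul, mul_add, map_add, map_add, h1, h2]
  | add_right X Y Z _ _ _ h1 h2 => rw [add_mul, mul_add, map_add, map_add, h1, h2]
  | smul_left c X Y _ _ h => rw [smul_mul_assoc, mul_smul_comm, map_smul, map_smul, h]
  | smul_right c X Y _ _ h => rw [smul_mul_assoc, mul_smul_comm, map_smul, map_smul, h]

omit [Nontrivial (OTheta θ)] in
/-- Bounded sequences of functionals have pointwise limits along an ultrafilter. -/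
theorem exists_ultralimit {V : Type*} [NormedAddCommGroup V] [NormedSpace ℂ V]
    (ψ : ℕ → V →ₗ[ℂ] ℂ) (hψ : ∀ k X, ‖ψ k X‖ ≤ ‖X‖) (U : Ultrafilter ℕ) :
    ∃ ψ' : V →ₗ[ℂ] ℂ, ∀ X, Tendsto (fun k => ψ k X) U (𝓝 (ψ' X)) := by
  have h : ∀ X, ∃ z, Tendsto (fun k => ψ k X) U (𝓝 z) := by
    intro X
    obtain ⟨z, _, hz⟩ := (isCompact_closedBall (0 : ℂ) ‖X‖).ultrafilter_le_nhds
      (U.map fun k => ψ k X) (tendsto_principal.2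
        (Eventually.of_forall fun k => mem_closedBall_zero_iff.2 (hψ k X)))
    exact ⟨z, hz⟩
  choose g hg using h
  refine ⟨{ toFun := g, map_add' := fun X Y => ?_, map_smul' := fun c X => ?_ }, hg⟩
  · refine tendsto_nhds_unique (hg (X + Y)) ?_
    simpa only [map_add] using (hg X).add (hg Y)
  · refine tendsto_nhds_unique (hg (c • X)) ?_
    simpa only [map_smul, RingHom.id_apply] using (hg X).const_smul c

omit [Nontrivial (OTheta θ)] in
theorem exists_vectorState (π : ThetaRep θ) : ∃ φ : OTheta θ →ₗ[ℂ] ℂ,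
    φ 1 = 1 ∧ (∀ X, 0 ≤ φ (star X * X)) ∧ ∀ X, ‖φ X‖ ≤ ‖X‖ := by
  have h1 : ‖seqVec 0‖ = 1 := orthonormal_seqVec.1 0
  refine ⟨{ toFun := fun X => inner ℂ (seqVec 0) (rep π X (seqVec 0))
            map_add' := fun X Y => by rw [map_add, add_apply, inner_add_right]
            map_smul' := fun c X => by
              rw [map_smul, smul_apply, inner_smul_right]; rfl }, ?_, fun X => ?_, fun X => ?_⟩
  · change inner ℂ (seqVec 0) (rep π 1 (seqVec 0)) = 1
    rw [map_one]
    exact inner_self_eq_one_of_norm_eq_one h1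
  · change 0 ≤ inner ℂ (seqVec 0) (rep π (star X * X) (seqVec 0))
    rw [map_mul, map_star, mul_apply_eq_comp, ContinuousLinearMap.star_eq_adjoint,
      ContinuousLinearMap.adjoint_inner_right, inner_self_eq_norm_sq_to_K]
    exact (Complex.zero_le_real.2 (sq_nonneg ‖rep π X (seqVec 0)‖)).trans_eq (by simp)
  · change ‖inner ℂ (seqVec 0) (rep π X (seqVec 0))‖ ≤ _
    refine (norm_inner_le_norm _ _).trans ?_
    rw [h1, one_mul]
    refine ((rep π X).le_opNorm _).trans ?_
    rw [h1, mul_one]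
    exact NonUnitalStarAlgHom.norm_apply_le _ X

/-- The averages at degree (p, p) are contractive and, for p large, tracial on any two given levels.
An ultralimit is tracial on all levels, and continuity extends this to 𝔉 one variable at a time. -/
theorem exists_tracialState (π : ThetaRep θ) :
    ∃ τ : fixedAlgebra θ →ₗ[ℂ] ℂ, IsTracialState τ := by
  obtain ⟨φ, hφ1, hφ0, hφ⟩ := exists_vectorState π
  obtain ⟨ψ, hψ⟩ := exists_ultralimit (fun p : ℕ => wordAverage φ (p, p))
    (fun p => norm_wordAverage_le hφ (p, p)) (hyperfilter ℕ)
  have hbound : ∀ X, ‖ψ X‖ ≤ ‖X‖ := fun X =>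
    le_of_tendsto (hψ X).norm (Eventually.of_forall fun p => norm_wordAverage_le hφ (p, p) X)
  have hcont : Continuous ψ :=
    AddMonoidHomClass.continuous_of_bound ψ 1 fun X => by rw [one_mul]; exact hbound X
  have hlevel : ∀ k l : ℕ × ℕ, ∀ X ∈ level θ k, ∀ Y ∈ level θ l, ψ (X * Y) = ψ (Y * X) := by
    intro k l X hX Y hY
    refine tendsto_nhds_unique (hψ (X * Y)) ((hψ (Y * X)).congr' ?_)
    refine Nat.hyperfilter_le_atTop ?_
    filter_upwards [eventually_ge_atTop (k.1 + k.2 + l.1 + l.2)] with p hp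
    exact wordAverage_trace hφ1
      (level_mono (show l ≤ (p, p) from Prod.mk_le_mk.2 ⟨by omega, by omega⟩) hY)
      (level_mono (show k ≤ (p, p) from Prod.mk_le_mk.2 ⟨by omega, by omega⟩) hX)
  refine ⟨ψ ∘ₗ (fixedAlgebra θ).subtype.toAlgHom.toLinearMap, ?_, fun a => ?_, fun a b => ?_⟩
  · refine tendsto_nhds_unique (hψ 1) ?_
    simp only [wordAverage_one hφ1]
    exact tendsto_const_nhds
  · exact ge_of_tendsto (hψ (star (a : OTheta θ) * a))
      (Eventually.of_forall fun p => wordAverage_nonneg hφ0 (p, p) a)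
  · have h1 : ∀ k, ∀ X ∈ level θ k, ψ (X * b) = ψ (b * X) := by
      intro k X hX
      refine Set.EqOn.closure (f := fun Y => ψ (X * Y)) (g := fun Y => ψ (Y * X)) ?_
        (by fun_prop) (by fun_prop) (mem_closure_levels b)
      intro Y hY
      obtain ⟨l, hl⟩ := Set.mem_iUnion.1 hY
      exact hlevel k l X hX Y hl
    refine Set.EqOn.closure (f := fun X => ψ (X * b)) (g := fun X => ψ (b * X)) ?_
        (by fun_prop) (by fun_prop) (mem_closure_levels a)
    intro X hX
    obtain ⟨k, hk⟩ := Set.mem_iUnion.1 hX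
    exact h1 k X hk

end OTheta

end

noncomputable section

/-! ### The state `ω` -/

namespace OTheta

open FTheta

variable {m n : ℕ} {θ : Equiv.Perm (Fin m × Fin n)} [Nontrivial (OTheta θ)]
  {τ : fixedAlgebra θ →ₗ[ℂ] ℂ}

theorem stateOf_spectral (hτ : IsTracialState τ) {g : ℤ × ℤ} (hg : g ≠ 0) {X : OTheta θ}
    (hX : X ∈ spectral θ g) : stateOf hτ X = 0 := by
  rw [stateOf_apply]
  have : Phi X = 0 := Subtype.ext (gaugeAverage_of_mem_spectral hg hX)
  rw [this, map_zero]

theorem stateOf_star (hτ : IsTracialState τ) (X : OTheta θ) :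
    stateOf hτ (star X) = star (stateOf hτ X) := map_star (stateOf hτ) X

theorem exists_mem_level {X : OTheta θ} (hX : X ∈ coreSpan θ) (hF : X ∈ fixedAlgebra θ) :
    ∃ k, X ∈ level θ k := by
  obtain ⟨k, hk⟩ := exists_mem_level_of_mem_coreSpan hX
  exact ⟨k, by rwa [gaugeAverage_of_mem_fixedAlgebra hF] at hk⟩

/-- On a matrix unit s_u s_v* only w = u survives and leaves s_v* s_u, which is 1 or 0. The trace
thereby appears as a scalar in the algebra, which yields faithfulness on the levels. -/
theorem IsFixedTrace.card_smul_one {φ : OTheta θ →ₗ[ℂ] ℂ} (h : IsFixedTrace φ) {k : ℕ × ℕ}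
    {Y : OTheta θ} (hY : Y ∈ level θ k) :
    ∑ w ∈ words θ k, star (s w) * Y * s w = (((words θ k).card : ℂ) * φ Y) • (1 : OTheta θ) := by
  induction hY using Submodule.span_induction with
  | mem Y hY =>
    obtain ⟨u, hu, v, hv, rfl⟩ := hY
    have hu' := mem_words.1 hu
    have hv' := mem_words.1 hv
    rw [Finset.sum_eq_single u]
    · have e : star (s u) * (s u * star (s v)) * s u =
          (star (s u) * s u) * (star (s v) * s u : OTheta θ) := by noncomm_ring
      rw [e, star_s_mul_s, one_mul]
      by_cases huv : u = v
      · subst huv hu'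
        rw [h.apply_self, star_s_mul_s, one_smul]
      · rw [h.apply_of_ne (hu'.trans hv'.symm) huv,
          star_s_mul_s_of_ne (hv'.trans hu'.symm) (Ne.symm huv), mul_zero, zero_smul]
    · intro w hw hne
      have e : star (s w) * (s u * star (s v)) * s w =
          (star (s w) * s u) * (star (s v) * s w : OTheta θ) := by noncomm_ring
      rw [e, star_s_mul_s_of_ne ((mem_words.1 hw).trans hu'.symm) hne, zero_mul]
    · exact fun h => absurd hu h
  | zero => simp
  | add X Y _ _ hX hY =>
    simp only [mul_add, add_mul, Finset.sum_add_distrib, hX, hY, map_add, add_smul]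
  | smul c X _ hX =>
    simp only [mul_smul_comm, smul_mul_assoc, ← Finset.smul_sum, hX, map_smul, smul_smul,
      smul_eq_mul]
    congr 1
    ring

/-- The trace is faithful on the matrix algebras. -/
theorem IsFixedTrace.eq_zero_of_level {φ : OTheta θ →ₗ[ℂ] ℂ} (h : IsFixedTrace φ) {k : ℕ × ℕ}
    {b : OTheta θ} (hY : star b * b ∈ level θ k) (h0 : φ (star b * b) = 0) : b = 0 := by
  -- Zero trace makes the sum of the positive elements (b s_w)*(b s_w) vanish, so every b s_w is 0
  -- and b = ∑ b s_w s_w* = 0.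
  have h1 := h.card_smul_one hY
  rw [h0, mul_zero, zero_smul] at h1
  have e : ∀ w, star (s w) * (star b * b) * s w = star (b * s w) * (b * s w) := fun w => by
    rw [star_mul]; noncomm_ring
  simp only [e] at h1
  rw [Finset.sum_eq_zero_iff_of_nonneg fun _ _ => star_mul_self_nonneg _] at h1
  calc b = b * ∑ w ∈ words θ k, s w * star (s w) := by rw [sum_words, mul_one]
    _ = 0 := by
      rw [Finset.mul_sum]
      refine Finset.sum_eq_zero fun w hw => ?_
      rw [← mul_assoc, (CStarRing.star_mul_self_eq_zero_iff _).1 (h1 w hw), zero_mul]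

/-! ### The KMS condition -/

/-- Since s_a* s_a = 1, Z ↦ s_a Z s_a* is multiplicative and preserves 𝔉, so composing with ω stays
tracial. The factor normalizes the value 1/N_a at 1, so uniqueness on the levels makes the result
agree with ω there. -/
theorem stateOf_conj_isFixedTrace (hτ : IsTracialState τ) (a : FTheta θ) :
    IsFixedTrace (((words θ (deg a)).card : ℂ) • ((stateOf hτ).toLinearMap ∘ₗ
      LinearMap.mulLeft ℂ (s a) ∘ₗ LinearMap.mulRight ℂ (star (s a)))) where
  map_one := by
    have h := (isFixedTrace_stateOf hτ).apply_self a
    simpa using h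
  trace X hX Y hY := by
    have hfix : ∀ Z ∈ fixedAlgebra θ, s a * (Z * star (s a)) ∈ fixedAlgebra θ := by
      intro Z hZ
      rw [mem_fixedAlgebra_iff] at hZ ⊢
      convert mul_mem_spectral (s_mem_spectral a)
        (mul_mem_spectral hZ (star_mem_spectral (s_mem_spectral a))) using 1
      simp
    have hmul : ∀ Z W, s a * (Z * W * star (s a)) =
        s a * (Z * star (s a)) * (s a * (W * star (s a))) := by
      intro Z W
      have e : s a * (Z * star (s a)) * (s a * (W * star (s a))) =
        s a * Z * (star (s a) * s a) * W * star (s a) := by noncomm_ring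
      rw [e, star_s_mul_s]
      noncomm_ring
    have h := (isFixedTrace_stateOf hτ).trace _ (hfix X hX) _ (hfix Y hY)
    rw [← hmul, ← hmul] at h
    exact congrArg (((words θ (deg a)).card : ℂ) * ·) h

/-- If the degree of Y cancels that of a, trace scaling turns ω(Y s_a) into N_a ω(s_a Y s_a s_a*),
with N_a the number of words of degree `deg a`; the trace property moves s_a s_a* to the front,
where s_a absorbs it. In all other degrees both sides vanish. -/
theorem stateOf_mul_s (hτ : IsTracialState τ) (a : FTheta θ) {Y : OTheta θ}
    (hY : Y ∈ coreSpan θ) :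
    stateOf hτ (Y * s a) = ((words θ (deg a)).card : ℂ) * stateOf hτ (s a * Y) := by
  induction hY using Submodule.span_induction with
  | mem Y h =>
    obtain ⟨u, v, rfl⟩ := h
    have hY := mem_coreSpan u v
    have hg := s_mul_star_s_mem_spectral u v
    -- From here on only the homogeneity of Y and its membership in the core matter.
    generalize s u * star (s v) = Y at hY hg
    generalize degDiff u v = g at hg
    have h1 := mul_mem_spectral hg (s_mem_spectral a)
    have h2 := mul_mem_spectral (s_mem_spectral a) hg
    rw [add_comm] at h2
    by_cases h0 : g + degDiff a 1 = 0
    · rw [h0, ← mem_fixedAlgebra_iff] at h1 h2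
      obtain ⟨k, hk⟩ := exists_mem_level (mul_mem_coreSpan hY (s_mem_coreSpan a)) h1
      have h3 := (isFixedTrace_stateOf hτ).eq_on_level (stateOf_conj_isFixedTrace hτ a) hk
      refine h3.trans (congrArg (((words θ (deg a)).card : ℂ) * ·) ?_)
      have h4 := (isFixedTrace_stateOf hτ).trace _ h2 _
        (unit_mem_fixedAlgebra (rfl : deg a = deg a))
      have e1 : s a * (Y * s a * star (s a)) = s a * Y * (s a * star (s a)) := by noncomm_ring
      have e2 : s a * star (s a) * (s a * Y) = s a * (star (s a) * s a) * Y := by noncomm_ring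
      rw [e2, star_s_mul_s, mul_one, ← e1] at h4
      exact h4
    · rw [stateOf_spectral hτ h0 h1, stateOf_spectral hτ h0 h2, mul_zero]
  | zero => simp
  | add X Y _ _ hX hY => rw [add_mul, mul_add, map_add, map_add, hX, hY, mul_add]
  | smul c X _ hX =>
    rw [smul_mul_assoc, mul_smul_comm, map_smul, map_smul, hX, smul_eq_mul, smul_eq_mul]
    ring

theorem stateOf_star_s_mul (hτ : IsTracialState τ) (b : FTheta θ) {Y : OTheta θ}
    (hY : Y ∈ coreSpan θ) :
    stateOf hτ (star (s b) * Y) = ((words θ (deg b)).card : ℂ) * stateOf hτ (Y * star (s b)) := by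
  have h := congrArg star (stateOf_mul_s hτ b (star_mem_coreSpan hY))
  rw [star_mul', ← stateOf_star, ← stateOf_star, star_mul, star_mul, star_star] at h
  simpa using h

/-- The KMS condition for `ω`. -/
theorem stateOf_mul_unit (hτ : IsTracialState τ) (a b : FTheta θ) {Y : OTheta θ}
    (hY : Y ∈ coreSpan θ) :
    ((words θ (deg b)).card : ℂ) * stateOf hτ (Y * (s a * star (s b))) =
      ((words θ (deg a)).card : ℂ) * stateOf hτ (s a * star (s b) * Y) := by
  rw [← mul_assoc, ← stateOf_star_s_mul hτ b (mul_mem_coreSpan hY (s_mem_coreSpan a)), ← mul_assoc,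
    stateOf_mul_s hτ a, mul_assoc]
  have := s_mul_mem_coreSpan 1 1 (mul_mem_coreSpan (star_mem_coreSpan (s_mem_coreSpan b)) hY)
  simpa using this

end OTheta

/-! ### The weights of the modular group -/

/-- The number `(m, n)^{-zg}`. -/
def modWeight (m n : ℕ) (z : ℂ) (g : ℤ × ℤ) : ℂ := (m : ℂ) ^ (-(z * g.1)) * (n : ℂ) ^ (-(z * g.2))

/-- The real number `(m, n)^{-g}`. -/
def modEigenvalue (m n : ℕ) (g : ℤ × ℤ) : ℝ := (m : ℝ) ^ (-(g.1 : ℝ)) * (n : ℝ) ^ (-(g.2 : ℝ))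

section Weights

variable {m n : ℕ}

theorem modWeight_zero_left (g : ℤ × ℤ) : modWeight m n 0 g = 1 := by simp [modWeight]

theorem modWeight_neg_neg (z : ℂ) (g : ℤ × ℤ) : modWeight m n (-z) (-g) = modWeight m n z g := by
  simp [modWeight]

theorem modWeight_conj (z : ℂ) (g : ℤ × ℤ) :
    star (modWeight m n z g) = modWeight m n (starRingEnd ℂ z) g := by
  have h : ∀ (k : ℕ) (w : ℂ), (starRingEnd ℂ) ((k : ℂ) ^ w) = (k : ℂ) ^ (starRingEnd ℂ w) := by
    intro k w
    have := Complex.cpow_conj (k : ℂ) w (by rw [Complex.natCast_arg]; exact Real.pi_pos.ne)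
    rw [this, Complex.conj_natCast]
  simp [modWeight, h]

theorem modEigenvalue_pos (hm : 1 ≤ m) (hn : 1 ≤ n) (g : ℤ × ℤ) : 0 < modEigenvalue m n g := by
  have h1 : (0 : ℝ) < m := by exact_mod_cast hm
  have h2 : (0 : ℝ) < n := by exact_mod_cast hn
  unfold modEigenvalue
  positivity

/-- The bases are nonnegative reals, so the usual power laws hold. This identifies the weight of
Δ(z) with the z-th power of the eigenvalue of the modular operator. -/
theorem modWeight_eq_cpow (hm : 1 ≤ m) (hn : 1 ≤ n) (z : ℂ) (g : ℤ × ℤ) :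
    modWeight m n z g = (modEigenvalue m n g : ℂ) ^ z := by
  have h1 : (0 : ℝ) < m := by exact_mod_cast hm
  have h2 : (0 : ℝ) < n := by exact_mod_cast hn
  have h : ∀ (k : ℕ) (x : ℤ), (0 : ℝ) < k →
      (((k : ℝ) ^ (-(x : ℝ)) : ℝ) : ℂ) ^ z = (k : ℂ) ^ (-(z * x)) := by
    intro k x hk
    rw [← Complex.cpow_mul_ofReal_nonneg hk.le]
    push_cast
    congr 1
    ring
  rw [modEigenvalue, Complex.ofReal_mul, Complex.mul_cpow_ofReal_nonneg (by positivity)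
    (by positivity), h m _ h1, h n _ h2, modWeight]

theorem modWeight_add_left (hm : 1 ≤ m) (hn : 1 ≤ n) (z w : ℂ) (g : ℤ × ℤ) :
    modWeight m n (z + w) g = modWeight m n z g * modWeight m n w g := by
  simp only [modWeight_eq_cpow hm hn]
  exact Complex.cpow_add _ _ (Complex.ofReal_ne_zero.2 (modEigenvalue_pos hm hn g).ne')

theorem modWeight_add_right (hm : 1 ≤ m) (hn : 1 ≤ n) (z : ℂ) (g h : ℤ × ℤ) :
    modWeight m n z (g + h) = modWeight m n z g * modWeight m n z h := by
  have h1 : (m : ℂ) ≠ 0 := by exact_mod_cast (by omega : m ≠ 0)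
  have h2 : (n : ℂ) ≠ 0 := by exact_mod_cast (by omega : n ≠ 0)
  simp only [modWeight, Prod.fst_add, Prod.snd_add, Int.cast_add, mul_add, neg_add,
    Complex.cpow_add _ _ h1, Complex.cpow_add _ _ h2]
  ring

theorem modWeight_one (hm : 1 ≤ m) (hn : 1 ≤ n) (g : ℤ × ℤ) :
    modWeight m n 1 g = modEigenvalue m n g := by
  rw [modWeight_eq_cpow hm hn, Complex.cpow_one]

theorem differentiable_modWeight (hm : 1 ≤ m) (hn : 1 ≤ n) (g : ℤ × ℤ) :
    Differentiable ℂ fun z => modWeight m n z g := by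
  simp only [modWeight_eq_cpow hm hn]
  exact fun z => differentiableAt_id.const_cpow
    (Or.inl (Complex.ofReal_ne_zero.2 (modEigenvalue_pos hm hn g).ne'))

theorem one_add_modWeight_ne_zero (hm : 1 ≤ m) (hn : 1 ≤ n) (t : ℝ) (g : ℤ × ℤ) :
    1 + modWeight m n t g ≠ 0 := by
  have h := modEigenvalue_pos hm hn g
  rw [modWeight_eq_cpow hm hn, ← Complex.ofReal_cpow h.le]
  have : 0 < 1 + modEigenvalue m n g ^ t := by positivity
  exact_mod_cast this.ne'

end Weights

/-- The weight of s_a s_b* under Δ(1) is a quotient of word counts; this converts the counting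
factors of the KMS identity into modular weights. -/
theorem OTheta.card_words_mul_modWeight {m n : ℕ} {θ : Equiv.Perm (Fin m × Fin n)}
    [Nontrivial (OTheta θ)] (hm : 1 ≤ m) (hn : 1 ≤ n) (a b : FTheta θ) :
    ((words θ (FTheta.deg a)).card : ℂ) * modWeight m n 1 (degDiff a b) =
      (words θ (FTheta.deg b)).card := by
  have h1 : (m : ℂ) ≠ 0 := by exact_mod_cast (by omega : m ≠ 0)
  have h2 : (n : ℂ) ≠ 0 := by exact_mod_cast (by omega : n ≠ 0)
  have h : ∀ (k : ℕ) (x y : ℕ), (k : ℂ) ≠ 0 →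
      (k : ℂ) ^ x * (k : ℂ) ^ (-(1 * (((x : ℤ) - y : ℤ) : ℂ))) = (k : ℂ) ^ y := by
    intro k x y hk
    rw [← Complex.cpow_natCast, ← Complex.cpow_natCast, ← Complex.cpow_add _ _ hk]
    congr 1
    push_cast
    ring
  rw [card_words, card_words, modWeight, degDiff]
  push_cast
  rw [mul_mul_mul_comm]
  have e1 := h m (FTheta.deg a).1 (FTheta.deg b).1 h1
  have e2 := h n (FTheta.deg a).2 (FTheta.deg b).2 h2
  push_cast at e1 e2
  rw [e1, e2]

end

noncomputable section

/-! ### The modular group -/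

/-- Operators that act by scalars on the summands of a direct sum decomposition. -/
theorem exists_linearMap_of_iSupIndep {I V : Type*} [AddCommGroup V] [Module ℂ V]
    {W : I → Submodule ℂ V} (hind : iSupIndep W) (htop : ⨆ i, W i = ⊤) (c : I → ℂ) :
    ∃ L : V →ₗ[ℂ] V, ∀ i, ∀ x ∈ W i, L x = c i • x := by
  classical
  have hint := DirectSum.isInternal_submodule_of_iSupIndep_of_iSup_eq_top hind htop
  let e := LinearEquiv.ofBijective (DirectSum.coeLinearMap W) hint
  refine ⟨(DirectSum.toModule ℂ I V fun i => c i • (W i).subtype) ∘ₗ e.symm.toLinearMap,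
    fun i x hx => ?_⟩
  have he : e.symm x = DirectSum.lof ℂ I (fun i => W i) i ⟨x, hx⟩ := by
    rw [LinearEquiv.symm_apply_eq]
    exact (DirectSum.coeLinearMap_lof W i ⟨x, hx⟩).symm
  change DirectSum.toModule ℂ I V (fun i => c i • (W i).subtype) (e.symm x) = _
  rw [he, DirectSum.toModule_lof]
  rfl

namespace OTheta

open FTheta

variable {m n : ℕ} {θ : Equiv.Perm (Fin m × Fin n)} [Nontrivial (OTheta θ)]

variable (θ) in
/-- The homogeneous elements of degree `g` of the algebra spanned by the `s_u s_v*`. -/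
def homog (g : ℤ × ℤ) : Submodule ℂ (coreAlgebra θ) :=
  (spectral θ g).comap (coreAlgebra θ).subtype.toAlgHom.toLinearMap

theorem mem_homog {g : ℤ × ℤ} {A : coreAlgebra θ} :
    A ∈ homog θ g ↔ (A : OTheta θ) ∈ spectral θ g := Iff.rfl

/-- The element `s_u s_v*` of the dense subalgebra. -/
def unit (u v : FTheta θ) : coreAlgebra θ := ⟨s u * star (s v), mem_coreSpan u v⟩

theorem unit_mem_homog (u v : FTheta θ) : unit u v ∈ homog θ (degDiff u v) :=
  s_mul_star_s_mem_spectral u v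

theorem core_induction {P : coreAlgebra θ → Prop} (unit : ∀ u v, P (unit u v)) (zero : P 0)
    (add : ∀ A B, P A → P B → P (A + B)) (smul : ∀ (c : ℂ) A, P A → P (c • A))
    (A : coreAlgebra θ) : P A := by
  obtain ⟨X, hX⟩ := A
  induction hX using Submodule.span_induction with
  | mem X h =>
    obtain ⟨u, v, rfl⟩ := h
    exact unit u v
  | zero => exact zero
  | add X Y hX hY h1 h2 => exact add ⟨X, hX⟩ ⟨Y, hY⟩ h1 h2
  | smul c X hX h => exact smul c ⟨X, hX⟩ h

theorem homog_induction {P : coreAlgebra θ → Prop} (homog : ∀ g, ∀ A ∈ homog θ g, P A)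
    (add : ∀ A B, P A → P B → P (A + B)) (A : coreAlgebra θ) : P A := by
  have h : A ∈ ⨆ g, OTheta.homog θ g := by
    induction A using core_induction with
    | unit u v => exact Submodule.mem_iSup_of_mem _ (unit_mem_homog u v)
    | zero => exact Submodule.zero_mem _
    | add A B hA hB => exact Submodule.add_mem _ hA hB
    | smul c A hA => exact Submodule.smul_mem _ c hA
  induction h using Submodule.iSup_induction' with
  | mem g A h => exact homog g A h
  | zero => exact homog 0 0 (Submodule.zero_mem _)
  | add A B _ _ hA hB => exact add A B hA hB

theorem iSup_homog : ⨆ g, homog θ g = ⊤ := by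
  refine eq_top_iff.2 fun A _ => ?_
  induction A using homog_induction with
  | homog g A hA => exact Submodule.mem_iSup_of_mem g hA
  | add A B hA hB => exact Submodule.add_mem _ (hA trivial) (hB trivial)

omit [Nontrivial (OTheta θ)] in
theorem gauge_mem_coreSpan (t : Circle × Circle) {X : OTheta θ} (hX : X ∈ coreSpan θ) :
    gauge t X ∈ coreSpan θ := by
  induction hX using Submodule.span_induction with
  | mem X h =>
    obtain ⟨u, v, rfl⟩ := h
    rw [s_mul_star_s_mem_spectral u v t]
    exact Submodule.smul_mem _ _ (mem_coreSpan u v)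
  | zero => rw [map_zero]; exact Submodule.zero_mem _
  | add X Y _ _ hX hY => rw [map_add]; exact Submodule.add_mem _ hX hY
  | smul c X _ hX => rw [map_smul]; exact Submodule.smul_mem _ c hX

variable (θ) in
/-- The gauge action on the dense subalgebra. -/
def gaugeCore (t : Circle × Circle) : Module.End ℂ (coreAlgebra θ) where
  toFun A := ⟨gauge t A, gauge_mem_coreSpan t A.2⟩
  map_add' A B := Subtype.ext (map_add (gauge t) (A : OTheta θ) B)
  map_smul' c A := Subtype.ext (map_smul (gauge t) c (A : OTheta θ))

theorem gaugeCore_commute (t r : Circle × Circle) : Commute (gaugeCore θ t) (gaugeCore θ r) := by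
  refine LinearMap.ext fun A => Subtype.ext ?_
  change gauge t (gauge r (A : OTheta θ)) = gauge r (gauge t (A : OTheta θ))
  rw [gauge_gauge, gauge_gauge, mul_comm]

theorem torusChar_injective :
    Function.Injective fun (g : ℤ × ℤ) (t : Circle × Circle) => (torusChar g t : ℂ) := by
  intro g h hgh
  by_contra hne
  obtain ⟨t, ht⟩ := exists_torusChar_ne hne
  exact ht (Circle.ext (congrFun hgh t))

theorem homog_le (g : ℤ × ℤ) :
    homog θ g ≤ ⨅ t, (gaugeCore θ t).maxGenEigenspace (torusChar g t : ℂ) := by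
  refine le_iInf fun t A hA => ?_
  refine (Module.End.mem_maxGenEigenspace _ _ _).2 ⟨1, ?_⟩
  rw [pow_one, LinearMap.sub_apply, sub_eq_zero]
  exact Subtype.ext (hA t)

/-- The homogeneous parts lie in joint eigenspaces of the commuting γ_t for distinct characters.
Independence is what makes Δ(z) well defined, as the spanning elements s_u s_v* are linearly
dependent. -/
theorem iSupIndep_homog : iSupIndep (homog θ) :=
  ((Module.End.independent_iInf_maxGenEigenspace_of_forall_mapsTo (gaugeCore θ) fun t r φ =>
    Module.End.mapsTo_maxGenEigenspace_of_comm (gaugeCore_commute r t) φ).comp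
      torusChar_injective).mono homog_le

variable (θ) in
/-- The modular group. -/
def modGroup (z : ℂ) : coreAlgebra θ →ₗ[ℂ] coreAlgebra θ :=
  (exists_linearMap_of_iSupIndep iSupIndep_homog iSup_homog (modWeight m n z)).choose

theorem modGroup_apply (z : ℂ) {g : ℤ × ℤ} {A : coreAlgebra θ} (hA : A ∈ homog θ g) :
    modGroup θ z A = modWeight m n z g • A :=
  (exists_linearMap_of_iSupIndep iSupIndep_homog iSup_homog (modWeight m n z)).choose_spec g A hA

theorem modGroup_mul (hm : 1 ≤ m) (hn : 1 ≤ n) (z : ℂ) (A B : coreAlgebra θ) :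
    modGroup θ z (A * B) = modGroup θ z A * modGroup θ z B := by
  induction A using homog_induction with
  | homog g A hA =>
    induction B using homog_induction with
    | homog h B hB =>
      rw [modGroup_apply z (show A * B ∈ homog θ (g + h) from mul_mem_spectral hA hB),
        modGroup_apply z hA, modGroup_apply z hB, smul_mul_smul_comm, modWeight_add_right hm hn]
    | add B C hB hC => rw [mul_add, map_add, map_add, mul_add, hB, hC]
  | add A C hA hC => rw [add_mul, map_add, map_add, add_mul, hA, hC]

theorem star_modGroup (z : ℂ) (A : coreAlgebra θ) :
    star (modGroup θ z A) = modGroup θ (-(starRingEnd ℂ z)) (star A) := by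
  induction A using homog_induction with
  | homog g A hA =>
    rw [modGroup_apply z hA,
      modGroup_apply _ (show star A ∈ homog θ (-g) from star_mem_spectral hA), star_smul,
      modWeight_neg_neg, modWeight_conj]
  | add A B hA hB => rw [map_add, star_add, star_add, map_add, hA, hB]

/-! ### The inner product of `ω` and the Tomita algebra axioms -/

section InnerProduct

variable {τ : fixedAlgebra θ →ₗ[ℂ] ℂ} (hτ : IsTracialState τ)

/-- The inner product `⟨A|B⟩ = ω(A* B)`. -/
def coreInner (A B : coreAlgebra θ) : ℂ := stateOf hτ (star (A : OTheta θ) * (B : OTheta θ))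

theorem coreInner_add_right (A B C : coreAlgebra θ) :
    coreInner hτ A (B + C) = coreInner hτ A B + coreInner hτ A C := by
  simp [coreInner, mul_add]

theorem coreInner_add_left (A B C : coreAlgebra θ) :
    coreInner hτ (A + B) C = coreInner hτ A C + coreInner hτ B C := by
  simp [coreInner, add_mul]

theorem coreInner_smul_right (c : ℂ) (A B : coreAlgebra θ) :
    coreInner hτ A (c • B) = c * coreInner hτ A B := by
  simp [coreInner]

theorem coreInner_smul_left (c : ℂ) (A B : coreAlgebra θ) :
    coreInner hτ (c • A) B = star c * coreInner hτ A B := by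
  simp [coreInner]

theorem coreInner_symm (A B : coreAlgebra θ) : coreInner hτ B A = star (coreInner hτ A B) := by
  rw [coreInner, coreInner, ← stateOf_star, star_mul, star_star]

theorem coreInner_of_ne {g h : ℤ × ℤ} (hgh : g ≠ h) {A B : coreAlgebra θ} (hA : A ∈ homog θ g)
    (hB : B ∈ homog θ h) : coreInner hτ A B = 0 :=
  stateOf_spectral hτ (fun h0 => hgh (neg_add_eq_zero.1 h0))
    (mul_mem_spectral (star_mem_spectral hA) hB)

/-- For homogeneous A the element A*A is gauge invariant, hence lies in a level, where the trace is
faithful. -/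
theorem coreInner_definite_of_homog {g : ℤ × ℤ} {A : coreAlgebra θ} (hA : A ∈ homog θ g)
    (h0 : coreInner hτ A A = 0) : A = 0 := by
  have h1 := mul_mem_spectral (star_mem_spectral hA) hA
  rw [neg_add_cancel, ← mem_fixedAlgebra_iff] at h1
  obtain ⟨k, hk⟩ := exists_mem_level (star A * A).2 h1
  exact Subtype.ext ((isFixedTrace_stateOf hτ).eq_zero_of_level hk h0)

theorem coreInner_nonneg (A : coreAlgebra θ) : 0 ≤ coreInner hτ A A :=
  (stateOf hτ).map_nonneg (star_mul_self_nonneg _)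

/-- By orthogonality ω(A*A) is the sum of the nonnegative contributions of the homogeneous
components, which reduces the claim to a single degree. -/
theorem coreInner_definite (A : coreAlgebra θ) (h0 : coreInner hτ A A = 0) : A = 0 := by
  obtain ⟨f, hf, rfl⟩ := (Submodule.mem_iSup_iff_exists_finsupp (homog θ) A).1
    (by rw [iSup_homog]; trivial)
  have hsum : coreInner hτ (f.sum fun _ x => x) (f.sum fun _ x => x) =
      ∑ i ∈ f.support, coreInner hτ (f i) (f i) := by
    have hl : ∀ (S : Finset (ℤ × ℤ)) B, coreInner hτ (∑ i ∈ S, f i) B =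
        ∑ i ∈ S, coreInner hτ (f i) B := fun S B =>
      map_sum ({ toFun := fun A => coreInner hτ A B
                 map_zero' := by simp [coreInner]
                 map_add' := fun A C => coreInner_add_left hτ A C B } : coreAlgebra θ →+ ℂ) _ _
    have hr : ∀ (S : Finset (ℤ × ℤ)) B, coreInner hτ B (∑ i ∈ S, f i) =
        ∑ i ∈ S, coreInner hτ B (f i) := fun S B =>
      map_sum ({ toFun := fun A => coreInner hτ B A
                 map_zero' := by simp [coreInner]
                 map_add' := fun A C => coreInner_add_right hτ B A C } : coreAlgebra θ →+ ℂ) _ _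
    rw [Finsupp.sum, hl]
    refine Finset.sum_congr rfl fun i hi => ?_
    rw [hr, Finset.sum_eq_single i]
    · exact fun j _ hj => coreInner_of_ne hτ (Ne.symm hj) (hf i) (hf j)
    · exact fun h => absurd hi h
  rw [hsum, Finset.sum_eq_zero_iff_of_nonneg fun i _ => coreInner_nonneg hτ (f i)] at h0
  exact Finset.sum_eq_zero fun i hi => coreInner_definite_of_homog hτ (hf i) (h0 i hi)

theorem coreInner_modGroup (z : ℂ) (A B : coreAlgebra θ) :
    coreInner hτ (modGroup θ z A) B = coreInner hτ A (modGroup θ (starRingEnd ℂ z) B) := by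
  induction A using homog_induction with
  | homog g A hA =>
    induction B using homog_induction with
    | homog h B hB =>
      rw [modGroup_apply z hA, modGroup_apply _ hB, coreInner_smul_left, coreInner_smul_right,
        modWeight_conj]
      by_cases hgh : g = h
      · rw [hgh]
      · rw [coreInner_of_ne hτ hgh hA hB, mul_zero, mul_zero]
    | add B C hB hC => rw [map_add, coreInner_add_right, coreInner_add_right, hB, hC]
  | add A C hA hC => rw [map_add, coreInner_add_left, coreInner_add_left, hA, hC]

/-- For A = s_a s_b* this is the KMS identity with the ratio of word counts rewritten as a weight;
both sides are linear in A. -/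
theorem coreInner_modGroup_star (hm : 1 ≤ m) (hn : 1 ≤ n) (A B : coreAlgebra θ) :
    coreInner hτ (modGroup θ 1 (star A)) (star B) = coreInner hτ B A := by
  induction A using core_induction with
  | unit a b =>
    rw [modGroup_apply 1 (show star (unit a b) ∈ homog θ (-degDiff a b) from
      star_mem_spectral (unit_mem_homog a b)), coreInner_smul_left, modWeight_conj, map_one]
    have h := stateOf_mul_unit hτ a b (star B).2
    have hw := card_words_mul_modWeight (θ := θ) hm hn a b
    have hinv : modWeight m n 1 (-degDiff a b) * modWeight m n 1 (degDiff a b) = 1 := by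
      rw [← modWeight_add_right hm hn, neg_add_cancel]
      simp [modWeight]
    have e1 : coreInner hτ (star (unit a b)) (star B) =
        stateOf hτ (s a * star (s b) * star (B : OTheta θ)) := by
      rw [coreInner]
      congr 2
      exact star_star (s a * star (s b) : OTheta θ)
    have e2 : coreInner hτ B (unit a b) = stateOf hτ (star (B : OTheta θ) * (s a * star (s b))) :=
      rfl
    rw [e1, e2]
    refine mul_left_cancel₀ (words_card_ne_zero (θ := θ) (deg b)) ?_
    refine Eq.trans ?_ h.symm
    rw [← hw]
    linear_combination ((words θ (deg a)).card : ℂ) *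
      stateOf hτ (s a * star (s b) * star (B : OTheta θ)) * hinv
  | zero => simp [coreInner]
  | add A C hA hC =>
    rw [star_add, map_add, coreInner_add_left, coreInner_add_right, hA, hC]
  | smul c A hA =>
    rw [star_smul, map_smul, coreInner_smul_left, coreInner_smul_right, hA, star_star]

/-- For real t the weights are positive, so 1 + Δ(t) is invertible in each degree and is onto, not
merely of dense range. -/
theorem exists_one_add_modGroup (hm : 1 ≤ m) (hn : 1 ≤ n) (t : ℝ) (A : coreAlgebra θ) :
    ∃ B, B + modGroup θ t B = A := by
  induction A using homog_induction with
  | homog g A hA =>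
    refine ⟨(1 + modWeight m n t g)⁻¹ • A, ?_⟩
    rw [map_smul, modGroup_apply _ hA, smul_smul, ← add_smul]
    have h := one_add_modWeight_ne_zero hm hn t g
    rw [← mul_one_add, inv_mul_cancel₀ h, one_smul]
  | add A C hA hC =>
    obtain ⟨B, rfl⟩ := hA
    obtain ⟨D, rfl⟩ := hC
    exact ⟨B + D, by rw [map_add]; abel⟩

/-- This is the bound of the GNS representation: left multiplication by A has norm at most ‖A‖ in
the seminorm of ω. -/
theorem coreInner_mul_le (A B : coreAlgebra θ) :
    (coreInner hτ (A * B) (A * B)).re ≤ ‖(A : OTheta θ)‖ ^ 2 * (coreInner hτ B B).re := by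
  have h := ((stateOf hτ).leftMulMapPreGNS (A : OTheta θ)).le_of_opNorm_le
    (LinearMap.mkContinuous_norm_le _ (norm_nonneg _) _) ((stateOf hτ).toPreGNS (B : OTheta θ))
  have h2 := pow_le_pow_left₀ (norm_nonneg _) h 2
  rw [mul_pow] at h2
  have e : ∀ C : coreAlgebra θ,
      ‖(stateOf hτ).toPreGNS (C : OTheta θ)‖ ^ 2 = (coreInner hτ C C).re := by
    intro C
    have := congrArg Complex.re
      ((stateOf hτ).preGNS_norm_sq ((stateOf hτ).toPreGNS (C : OTheta θ)))
    exact_mod_cast this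
  rw [← e, ← e]
  exact h2

theorem isModularHilbertAlgebra (hm : 1 ≤ m) (hn : 1 ≤ n) :
    IsModularHilbertAlgebra (coreInner hτ) (modGroup θ) where
  ip_add := coreInner_add_right hτ
  ip_smul := coreInner_smul_right hτ
  ip_symm := coreInner_symm hτ
  ip_nonneg := coreInner_nonneg hτ
  ip_definite := coreInner_definite hτ
  group_zero A := by
    induction A using homog_induction with
    | homog g A hA => rw [modGroup_apply 0 hA, modWeight_zero_left, one_smul]
    | add A B hA hB => rw [map_add, hA, hB]
  group_add z w A := by
    induction A using homog_induction with
    | homog g A hA =>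
      rw [modGroup_apply _ hA, modGroup_apply _ hA, map_smul, modGroup_apply _ hA, smul_smul,
        modWeight_add_left hm hn, mul_comm]
    | add A B hA hB => rw [map_add, map_add, map_add, hA, hB]
  map_mul := modGroup_mul hm hn
  ip_mul_left A B C := by
    simp only [coreInner, MulMemClass.coe_mul, StarMemClass.coe_star, star_mul, mul_assoc]
  mul_continuous A := ⟨_, coreInner_mul_le hτ A⟩
  mul_dense A ε hε := ⟨A, Submodule.subset_span ⟨A, 1, (mul_one A).symm⟩, by
    simpa [coreInner] using hε⟩
  star_group := star_modGroup
  ip_group := coreInner_modGroup hτ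
  ip_star := coreInner_modGroup_star hτ hm hn
  analytic A B := by
    induction B using homog_induction with
    | homog g B hB =>
      simp only [modGroup_apply _ hB, coreInner_smul_right]
      exact (differentiable_modWeight hm hn g).mul_const _
    | add B C hB hC =>
      simp only [map_add, coreInner_add_right]
      exact hB.add hC
  dense_one_add t A ε hε := by
    obtain ⟨B, hB⟩ := exists_one_add_modGroup hm hn t A
    exact ⟨B, by rw [hB]; simpa [coreInner] using hε⟩

end InnerProduct

end OTheta

end

noncomputable section

/-! ### The modular operator of a graded involutive algebra -/

section Tomita

open Filter Topology

variable {I 𝔄 H : Type*} [AddCommGroup I] [AddCommGroup 𝔄] [Module ℂ 𝔄] [StarAddMonoid 𝔄]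
  [NormedAddCommGroup H] [InnerProductSpace ℂ H]

/-- The graph of S is closed under addition, and so is its closure. Antilinearity prevents it from
being a complex subspace in general, hence the `AddSubmonoid`. -/
theorem sum_mem_tomitaClosure {J : Type*} (ι : 𝔄 →ₗ[ℂ] H) (S : Finset J) (x y : J → H)
    (hxy : ∀ g ∈ S, (x g, y g) ∈ tomitaClosure ι) : ∑ g ∈ S, (x g, y g) ∈ tomitaClosure ι := by
  let N : AddSubmonoid (H × H) := AddMonoidHom.mrange
    ({ toFun := fun A => (ι A, ι (star A))
       map_zero' := by simp
       map_add' := fun A B => by simp } : 𝔄 →+ H × H)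
  have hN : tomitaClosure ι = (N.topologicalClosure : Set (H × H)) := rfl
  rw [hN] at hxy ⊢
  exact sum_mem hxy

/-- A graded vector space with an involution and a map into a Hilbert space, such that the
involution is, up to the factors `l g`, isometric on the homogeneous elements. -/
structure IsGradedTomita (ι : 𝔄 →ₗ[ℂ] H) (W : I → Submodule ℂ 𝔄) (l : I → ℝ) : Prop where
  dense : DenseRange ι
  iSup_eq_top : ⨆ g, W g = ⊤
  orthogonal : ∀ g h, g ≠ h → ∀ A ∈ W g, ∀ B ∈ W h, inner ℂ (ι A) (ι B) = 0
  star_mem : ∀ g, ∀ A ∈ W g, star A ∈ W (-g)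
  inner_star : ∀ g, ∀ A ∈ W g, ∀ B ∈ W g,
    inner ℂ (ι (star A)) (ι (star B)) = l g * inner ℂ (ι B) (ι A)

/-- The closure of the homogeneous elements of degree `g`. -/
def gradedPart (ι : 𝔄 →ₗ[ℂ] H) (W : I → Submodule ℂ 𝔄) (g : I) : Submodule ℂ H :=
  ((W g).map ι).topologicalClosure

instance [CompleteSpace H] (ι : 𝔄 →ₗ[ℂ] H) (W : I → Submodule ℂ 𝔄) (g : I) :
    CompleteSpace (gradedPart ι W g) :=
  (Submodule.isClosed_topologicalClosure _).completeSpace_coe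

namespace IsGradedTomita

variable {ι : 𝔄 →ₗ[ℂ] H} {W : I → Submodule ℂ 𝔄} {l : I → ℝ} (h : IsGradedTomita ι W l)
include h

theorem induction {P : 𝔄 → Prop} (homog : ∀ g, ∀ A ∈ W g, P A)
    (add : ∀ A B, P A → P B → P (A + B)) (A : 𝔄) : P A := by
  have hA : A ∈ ⨆ g, W g := by rw [h.iSup_eq_top]; trivial
  induction hA using Submodule.iSup_induction' with
  | mem g A h => exact homog g A h
  | zero => exact homog 0 0 (Submodule.zero_mem _)
  | add A B _ _ hA hB => exact add A B hA hB

theorem isOrtho {g g' : I} (hg : g ≠ g') : gradedPart ι W g ⟂ gradedPart ι W g' := by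
  have h1 : (W g).map ι ⟂ (W g').map ι := by
    rw [Submodule.isOrtho_iff_inner_eq]
    rintro _ ⟨A, hA, rfl⟩ _ ⟨B, hB, rfl⟩
    exact h.orthogonal g g' hg A hA B hB
  have h2 : gradedPart ι W g ⟂ (W g').map ι :=
    Submodule.topologicalClosure_minimal _ h1 (Submodule.isClosed_orthogonal _)
  have h3 : gradedPart ι W g' ⟂ gradedPart ι W g :=
    Submodule.topologicalClosure_minimal _ h2.symm (Submodule.isClosed_orthogonal _)
  exact h3.symm

theorem eq_zero_of_inner {η : H} (hη : ∀ g, ∀ A ∈ W g, inner ℂ (ι A) η = 0) : η = 0 := by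
  refine h.dense.eq_zero_of_inner_left ℂ fun A => ?_
  rw [inner_eq_zero_symm]
  induction A using h.induction with
  | homog g A hA => exact hη g A hA
  | add A B hA hB => rw [map_add, inner_add_left, hA, hB, add_zero]

/-- Components of B in degrees other than g contribute 0 to both sides. Read as a statement about F,
it says that F maps ι A* to l_g ι A. -/
theorem inner_star_right {g : I} {A : 𝔄} (hA : A ∈ W g) (B : 𝔄) :
    inner ℂ (ι (star A)) (ι (star B)) = l g * inner ℂ (ι B) (ι A) := by
  induction B using h.induction with
  | homog g' B hB =>
    by_cases hg : g = g'
    · subst hg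
      exact h.inner_star g A hA B hB
    · rw [h.orthogonal (-g) (-g') (fun h => hg (neg_injective h)) _ (h.star_mem g A hA) _
        (h.star_mem g' B hB), h.orthogonal g' g (Ne.symm hg) _ hB _ hA, mul_zero]
  | add B C hB hC => rw [star_add, map_add, map_add, inner_add_right, inner_add_left, hB, hC,
      mul_add]

theorem inner_tomitaClosure {p : H × H} (hp : p ∈ tomitaClosure ι) {g : I} {A : 𝔄}
    (hA : A ∈ W g) : inner ℂ (ι (star A)) p.2 = l g * inner ℂ p.1 (ι A) := by
  have hcl : IsClosed {p : H × H | inner ℂ (ι (star A)) p.2 = l g * inner ℂ p.1 (ι A)} :=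
    isClosed_eq (by fun_prop) (by fun_prop)
  refine closure_minimal ?_ hcl hp
  rintro _ ⟨B, rfl⟩
  exact h.inner_star_right hA B

/-- The adjoint F is defined on the dense range of ι, which forces S to be closable. -/
theorem tomita_closable {η : H} (hη : (0, η) ∈ tomitaClosure ι) : η = 0 := by
  refine h.eq_zero_of_inner fun g A hA => ?_
  have h1 := h.inner_tomitaClosure hη (h.star_mem g A hA)
  rwa [star_star, inner_zero_left, mul_zero] at h1

theorem mem_tomitaAdjoint {ξ η ζ : H} (hξ : (ξ, η) ∈ tomitaClosure ι)
    (hζ : ∀ g, ∀ A ∈ W g, inner ℂ (ι A) ζ = l g * inner ℂ (ι A) ξ) :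
    (η, ζ) ∈ tomitaAdjoint ι := by
  intro A
  induction A using h.induction with
  | homog g A hA =>
    have h1 := congrArg (starRingEnd ℂ) (hζ g A hA)
    rw [map_mul, inner_conj_symm, inner_conj_symm, Complex.conj_ofReal] at h1
    exact (h.inner_tomitaClosure hξ hA).trans h1.symm
  | add A B hA hB =>
    rw [star_add, map_add, map_add, inner_add_left, inner_add_right, hA, hB]

theorem norm_star_sub_sq {g : I} {A B : 𝔄} (hA : A ∈ W g) (hB : B ∈ W g) :
    ‖ι (star A) - ι (star B)‖ ^ 2 = l g * ‖ι A - ι B‖ ^ 2 := by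
  have h1 := h.inner_star g _ (Submodule.sub_mem _ hA hB) _ (Submodule.sub_mem _ hA hB)
  rw [star_sub, map_sub, map_sub, inner_self_eq_norm_sq_to_K, inner_self_eq_norm_sq_to_K] at h1
  have h2 : ((‖ι (star A) - ι (star B)‖ : ℝ) : ℂ) ^ 2 = l g * ((‖ι A - ι B‖ : ℝ) : ℂ) ^ 2 := h1
  exact_mod_cast h2

variable [CompleteSpace H]

theorem isHilbertSum :
    IsHilbertSum ℂ (fun g => gradedPart ι W g) fun g => (gradedPart ι W g).subtypeₗᵢ := by
  refine IsHilbertSum.mkInternal _ (OrthogonalFamily.of_pairwise fun g g' hg => h.isOrtho hg) ?_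
  intro ξ _
  refine closure_mono ?_ (h.dense ξ)
  rintro _ ⟨A, rfl⟩
  induction A using h.induction with
  | homog g A hA =>
    exact Submodule.mem_iSup_of_mem g (Submodule.le_topologicalClosure _ ⟨A, hA, rfl⟩)
  | add A B hA hB => rw [map_add]; exact Submodule.add_mem _ hA hB

/-- The decomposition of the Hilbert space into the homogeneous parts. -/
def decomp : H ≃ₗᵢ[ℂ] lp (fun g => gradedPart ι W g) 2 := h.isHilbertSum.linearIsometryEquiv

theorem hasSum_decomp (ξ : H) : HasSum (fun g => (h.decomp ξ g : H)) ξ := by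
  have h1 := h.isHilbertSum.hasSum_linearIsometryEquiv_symm (h.decomp ξ)
  rwa [decomp, LinearIsometryEquiv.symm_apply_apply] at h1

theorem inner_decomp {g : I} {x : H} (hx : x ∈ gradedPart ι W g) (ξ : H) :
    inner ℂ x (h.decomp ξ g : H) = inner ℂ x ξ := by
  have h1 : HasSum (fun g => inner ℂ x (h.decomp ξ g : H)) (inner ℂ x ξ) :=
    (h.hasSum_decomp ξ).mapL (innerSL ℂ x)
  refine (hasSum_single g fun g' hg => ?_).unique h1
  exact Submodule.isOrtho_iff_inner_eq.1 (h.isOrtho (Ne.symm hg)) _ hx _ (h.decomp ξ g').2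

/-- The ι A with A in `W g` are dense in the g-th summand, so coordinates can be compared by testing
against them. This turns membership in the graph of a diagonal operator into scalar identities. -/
theorem decomp_eq_smul_iff {g : I} {ξ ζ : H} {c : ℂ} :
    h.decomp ζ g = c • h.decomp ξ g ↔ ∀ A ∈ W g, inner ℂ (ι A) ζ = c * inner ℂ (ι A) ξ := by
  have hmem : ∀ A ∈ W g, ι A ∈ gradedPart ι W g := fun A hA =>
    Submodule.le_topologicalClosure _ ⟨A, hA, rfl⟩
  constructor
  · intro heq A hA
    rw [← h.inner_decomp (hmem A hA) ζ, ← h.inner_decomp (hmem A hA) ξ, heq, Submodule.coe_smul,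
      inner_smul_right]
  · intro hA
    rw [← sub_eq_zero]
    set x := h.decomp ζ g - c • h.decomp ξ g with hx
    have h1 : ((W g).map ι) ≤ (ℂ ∙ (x : H))ᗮ := by
      rintro _ ⟨A, hAg, rfl⟩
      rw [Submodule.mem_orthogonal_singleton_iff_inner_left, hx, Submodule.coe_sub,
        Submodule.coe_smul, inner_sub_right, inner_smul_right, h.inner_decomp (hmem A hAg),
        h.inner_decomp (hmem A hAg), hA A hAg, sub_self]
    have h2 := Submodule.topologicalClosure_minimal _ h1 (Submodule.isClosed_orthogonal _) x.2
    rw [Submodule.mem_orthogonal_singleton_iff_inner_left, inner_self_eq_zero] at h2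
    exact Subtype.ext h2

theorem mem_graph_diagOp_iff {c : I → ℂ} {p : H × H} :
    p ∈ (diagOp h.decomp c).graph ↔
      ∀ g, ∀ A ∈ W g, inner ℂ (ι A) p.2 = c g * inner ℂ (ι A) p.1 :=
  (mem_graph_diagOp h.decomp c p).trans (forall_congr' fun _ => h.decomp_eq_smul_iff)

/-- In degree g the involution scales distances by √(l_g), so it maps Cauchy sequences to Cauchy
sequences and extends to the closure. -/
theorem exists_star_of_mem_gradedPart {g : I} {x : H} (hx : x ∈ gradedPart ι W g) :
    ∃ y ∈ gradedPart ι W (-g), (x, y) ∈ tomitaClosure ι ∧ ‖y‖ ^ 2 = l g * ‖x‖ ^ 2 := by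
  obtain ⟨u, hu, hux⟩ := mem_closure_iff_seq_limit.1 hx
  choose A hA hAu using hu
  have hx' : Tendsto (fun k => ι (A k)) atTop (𝓝 x) := by simpa only [hAu] using hux
  have hdist : ∀ j k, dist (ι (star (A j))) (ι (star (A k))) =
      √(l g * dist (ι (A j)) (ι (A k)) ^ 2) := by
    intro j k
    rw [dist_eq_norm, dist_eq_norm, ← h.norm_star_sub_sq (hA j) (hA k),
      Real.sqrt_sq (norm_nonneg _)]
  have hc : CauchySeq fun k => ι (star (A k)) := by
    rw [cauchySeq_iff_tendsto_dist_atTop_0]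
    simp only [hdist]
    have h1 := cauchySeq_iff_tendsto_dist_atTop_0.1 hx'.cauchySeq
    have h2 := (((h1.pow 2).const_mul (l g))).sqrt
    simpa using h2
  obtain ⟨y, hy⟩ := cauchySeq_tendsto_of_complete hc
  refine ⟨y, ?_, ?_, ?_⟩
  · exact mem_closure_of_tendsto hy (Eventually.of_forall fun k =>
      ⟨star (A k), h.star_mem g _ (hA k), rfl⟩)
  · exact mem_closure_of_tendsto (hx'.prodMk_nhds hy) (Eventually.of_forall fun k => ⟨A k, rfl⟩)
  · refine tendsto_nhds_unique (hy.norm.pow 2) ?_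
    have h1 : ∀ k, ‖ι (star (A k))‖ ^ 2 = l g * ‖ι (A k)‖ ^ 2 := fun k => by
      simpa using h.norm_star_sub_sq (hA k) (Submodule.zero_mem (W g))
    simp only [h1]
    exact (hx'.norm.pow 2).const_mul (l g)

/-- The domain of the diagonal operator lies in that of S̄: apply S̄ to each component, sum the
mutually orthogonal images, and use that the graph of S̄ is closed. -/
theorem exists_tomitaClosure (hl : ∀ g, 0 ≤ l g) {ξ ζ : H}
    (hζ : ∀ g, h.decomp ζ g = (l g : ℂ) • h.decomp ξ g) : ∃ η, (ξ, η) ∈ tomitaClosure ι := by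
  have hy : ∀ g, ∃ y ∈ gradedPart ι W (-g), ((h.decomp ξ g : H), y) ∈ tomitaClosure ι ∧
      ‖y‖ ^ 2 = l g * ‖(h.decomp ξ g : H)‖ ^ 2 := fun g =>
    h.exists_star_of_mem_gradedPart (h.decomp ξ g).2
  choose y hyg hyS hyn using hy
  have hsum : Summable fun g => ‖y g‖ ^ 2 := by
    refine Summable.of_nonneg_of_le (fun _ => sq_nonneg _) (fun g => ?_)
      ((hilbertSum_hasSum_norm_sq h.decomp ξ).summable.add
        (hilbertSum_hasSum_norm_sq h.decomp ζ).summable)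
    rw [hyn, hζ, norm_smul, mul_pow, Complex.norm_real, Real.norm_eq_abs, sq_abs,
      ← Submodule.coe_norm]
    have h1 := sq_nonneg ‖h.decomp ξ g‖
    generalize ‖h.decomp ξ g‖ ^ 2 = r at h1
    -- Here l ≤ 1 + l² is used: ‖y_g‖² = l_g ‖ξ_g‖² is bounded by ‖ξ_g‖² + ‖ζ_g‖².
    nlinarith [mul_nonneg (sq_nonneg (l g - 1)) h1, mul_nonneg (hl g) h1]
  -- S̄ reverses degrees, so the component of η in degree g is the image of the component of ξ in
  -- degree -g.
  have hmem : ∀ g, y (-g) ∈ gradedPart ι W g := fun g => by simpa only [neg_neg] using hyg (-g)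
  have hsum' : Summable fun g => ‖(⟨y (-g), hmem g⟩ : gradedPart ι W g)‖ ^ 2 := by
    simp only [Submodule.coe_norm]
    exact hsum.comp_injective neg_injective
  obtain ⟨η, hη⟩ := hilbertSum_exists h.decomp (fun g => ⟨y (-g), hmem g⟩) hsum'
  have h1 : HasSum y η := by
    have h2 : HasSum (fun g => y (-g)) η := by
      have h2 := h.hasSum_decomp η
      simpa only [hη] using h2
    exact (Equiv.neg I).hasSum_iff.1 h2
  have h3 := (h.hasSum_decomp ξ).prodMk h1
  refine ⟨η, isClosed_closure.mem_of_tendsto h3 (Eventually.of_forall fun S => ?_)⟩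
  exact sum_mem_tomitaClosure ι S _ y fun g _ => hyS g

theorem isModularOperator (hl : ∀ g, 0 ≤ l g) :
    IsModularOperator ι (diagOp h.decomp fun g => (l g : ℂ)) := by
  refine ⟨fun η hη => h.tomita_closable hη, fun ξ ζ => ?_⟩
  rw [h.mem_graph_diagOp_iff]
  constructor
  · intro hζ
    obtain ⟨η, hη⟩ := h.exists_tomitaClosure hl fun g => h.decomp_eq_smul_iff.2 (hζ g)
    exact ⟨η, hη, h.mem_tomitaAdjoint hη hζ⟩
  · rintro ⟨η, hη, hζ⟩ g A hA
    have h1 := congrArg (starRingEnd ℂ) ((hζ A).symm.trans (h.inner_tomitaClosure hη hA))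
    rwa [map_mul, inner_conj_symm, inner_conj_symm, Complex.conj_ofReal] at h1

theorem isComplexPower [Countable I] (hl : ∀ g, 0 < l g) (z : ℂ) :
    IsComplexPower (diagOp h.decomp fun g => (l g : ℂ)) z
      (diagOp h.decomp fun g => (l g : ℂ) ^ z) :=
  ⟨diagSpectral h.decomp l, diagSpectral_proj_eq_zero h.decomp fun g => not_le.2 (hl g),
    isIntegral_diagOp h.decomp l fun x => (x : ℂ),
    isIntegral_diagOp h.decomp l fun x => (x : ℂ) ^ z⟩

end IsGradedTomita

end Tomita

end

noncomputable section

/-! ### The GNS representation of `ω` -/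

namespace OTheta

open FTheta

variable {m n : ℕ} {θ : Equiv.Perm (Fin m × Fin n)} [Nontrivial (OTheta θ)]
  {τ : fixedAlgebra θ →ₗ[ℂ] ℂ} (hτ : IsTracialState τ)

/-- The embedding of the dense subalgebra into the GNS space of `ω`. -/
def coreGNS : coreAlgebra θ →ₗ[ℂ] (stateOf hτ).GNS where
  toFun A := gnsVector (stateOf hτ) (A : OTheta θ)
  map_add' A B := by
    rw [gnsVector, gnsVector, gnsVector, ← UniformSpace.Completion.coe_add, ← map_add]
    rfl
  map_smul' c A := by
    rw [gnsVector, gnsVector, RingHom.id_apply, ← UniformSpace.Completion.coe_smul, ← map_smul]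
    rfl

theorem inner_coreGNS (A B : coreAlgebra θ) :
    inner ℂ (coreGNS hτ A) (coreGNS hτ B) = coreInner hτ A B :=
  UniformSpace.Completion.inner_coe _ _

/-- X is the image of 1 under left multiplication by X, so its GNS norm is at most a constant times
‖X‖. Norm density of the core thus passes to the GNS space. -/
theorem continuous_gnsVector : Continuous (gnsVector (stateOf hτ)) := by
  refine (UniformSpace.Completion.continuous_coe _).comp ?_
  have hb : ∀ X : OTheta θ, ‖(stateOf hτ).toPreGNS X‖ ≤
      ‖(stateOf hτ).toPreGNS (1 : OTheta θ)‖ * ‖X‖ := by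
    intro X
    have h := ((stateOf hτ).leftMulMapPreGNS X).le_of_opNorm_le
      (LinearMap.mkContinuous_norm_le _ (norm_nonneg _) _) ((stateOf hτ).toPreGNS (1 : OTheta θ))
    have e : (stateOf hτ).leftMulMapPreGNS X ((stateOf hτ).toPreGNS (1 : OTheta θ)) =
        (stateOf hτ).toPreGNS X := by
      rw [PositiveLinearMap.leftMulMapPreGNS_apply, PositiveLinearMap.ofPreGNS_toPreGNS, mul_one]
    rw [e, mul_comm] at h
    exact h
  exact AddMonoidHomClass.continuous_of_bound (stateOf hτ).toPreGNS _ hb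

theorem denseRange_coreGNS : DenseRange (coreGNS hτ) := by
  have h1 : DenseRange (gnsVector (stateOf hτ)) :=
    UniformSpace.Completion.denseRange_coe.comp (stateOf hτ).toPreGNS.surjective.denseRange
      (UniformSpace.Completion.continuous_coe _)
  have h2 := h1.dense_image (continuous_gnsVector hτ) (dense_coreAlgebra (θ := θ))
  refine h2.mono ?_
  rintro _ ⟨X, hX, rfl⟩
  exact ⟨⟨X, hX⟩, rfl⟩

theorem isGradedTomita (hm : 1 ≤ m) (hn : 1 ≤ n) :
    IsGradedTomita (coreGNS hτ) (homog θ) (modEigenvalue m n) where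
  dense := denseRange_coreGNS hτ
  iSup_eq_top := iSup_homog
  orthogonal g h hgh A hA B hB := by
    rw [inner_coreGNS]
    exact coreInner_of_ne hτ hgh hA hB
  star_mem g A hA := star_mem_spectral hA
  inner_star g A hA B hB := by
    -- By axiom 6 the pairing of B with A is that of Δ(1)A* with B*; A* has degree -g, so its weight
    -- cancels the factor l_g.
    rw [inner_coreGNS, inner_coreGNS, ← coreInner_modGroup_star hτ hm hn A B,
      modGroup_apply 1 (show star A ∈ homog θ (-g) from star_mem_spectral hA),
      coreInner_smul_left, modWeight_conj, map_one, ← mul_assoc, ← modWeight_one hm hn,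
      ← modWeight_add_right hm hn, add_neg_cancel]
    simp [modWeight]

end OTheta

end

theorem theorem5p3 (m n : ℕ) (hm : 1 ≤ m) (hn : 1 ≤ n) (θ : Equiv.Perm (Fin m × Fin n)) :
    -- the fixed point algebra has exactly one tracial state
    (∃! τ : OTheta.fixedAlgebra θ →ₗ[ℂ] ℂ, IsTracialState τ) ∧
    ∀ τ : OTheta.fixedAlgebra θ →ₗ[ℂ] ℂ, IsTracialState τ →
      -- `ω = τ ∘ Φ` is a state
      ∃ ω : OTheta θ →ₚ[ℂ] ℂ, (∀ X, ω X = τ (OTheta.Phi X)) ∧ ω 1 = 1 ∧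
      -- `𝔄 = span {s_u s_v*}` is a dense *-subalgebra
      ∃ 𝔄 : StarSubalgebra ℂ (OTheta θ),
        (𝔄 : Set (OTheta θ)) =
          Submodule.span ℂ {X | ∃ u v : FTheta θ, X = OTheta.s u * star (OTheta.s v)} ∧
        Dense (𝔄 : Set (OTheta θ)) ∧
      ∃ Δ : ℂ → 𝔄 →ₗ[ℂ] 𝔄,
        -- it is a modular Hilbert algebra
        IsModularHilbertAlgebra (fun A B : 𝔄 => ω (star (A : OTheta θ) * (B : OTheta θ))) Δ ∧
        -- the formula on generators, and multiplicativity
        (∀ (z : ℂ) (u v : FTheta θ) (X : 𝔄),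
          (X : OTheta θ) = OTheta.s u * star (OTheta.s v) →
          Δ z X =
            ((m : ℂ) ^ (z * (((FTheta.deg v).1 : ℂ) - ((FTheta.deg u).1 : ℂ))) *
              (n : ℂ) ^ (z * (((FTheta.deg v).2 : ℂ) - ((FTheta.deg u).2 : ℂ)))) • X) ∧
        (∀ (z : ℂ) (A B : 𝔄), Δ z (A * B) = Δ z A * Δ z B) ∧
        -- `Δ z` is the restriction to `𝔄` of the `z`-th power of the modular operator
        ∃ T : ω.GNS →ₗ.[ℂ] ω.GNS,
          IsModularOperator (fun A : 𝔄 => gnsVector ω (A : OTheta θ)) T ∧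
          ∀ z : ℂ, ∃ R : ω.GNS →ₗ.[ℂ] ω.GNS, IsComplexPower T z R ∧
            ∀ A : 𝔄, (gnsVector ω (A : OTheta θ), gnsVector ω (Δ z A : OTheta θ)) ∈ R.graph := by
  have := OTheta.nontrivial hm hn θ
  refine ⟨?_, fun τ hτ => ⟨OTheta.stateOf hτ, OTheta.stateOf_apply hτ, OTheta.stateOf_one hτ,
    OTheta.coreAlgebra θ, rfl, OTheta.dense_coreAlgebra, OTheta.modGroup θ,
    OTheta.isModularHilbertAlgebra hτ hm hn, fun z u v X hX => ?_, OTheta.modGroup_mul hm hn, ?_⟩⟩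
  · obtain ⟨π⟩ := nonempty_thetaRep hm hn θ
    obtain ⟨τ, hτ⟩ := OTheta.exists_tracialState π
    exact ⟨τ, hτ, fun τ' hτ' => OTheta.tracialState_unique hτ' hτ⟩
  · have hX' : X ∈ OTheta.homog θ (OTheta.degDiff u v) := by
      rw [OTheta.mem_homog, hX]
      exact OTheta.s_mul_star_s_mem_spectral u v
    rw [OTheta.modGroup_apply z hX', modWeight, OTheta.degDiff]
    congr 3 <;> (push_cast; ring)
  · have h := OTheta.isGradedTomita hτ hm hn
    have hpos := modEigenvalue_pos hm hn
    refine ⟨_, h.isModularOperator fun g => (hpos g).le, fun z =>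
      ⟨_, h.isComplexPower hpos z, fun A => h.mem_graph_diagOp_iff.2 fun g B hB => ?_⟩⟩
    change inner ℂ (OTheta.coreGNS hτ B) (OTheta.coreGNS hτ (OTheta.modGroup θ z A)) =
      _ * inner ℂ (OTheta.coreGNS hτ B) (OTheta.coreGNS hτ A)
    rw [OTheta.inner_coreGNS, OTheta.inner_coreGNS, ← modWeight_eq_cpow hm hn]
    -- For A homogeneous of degree g' ≠ g both sides vanish by orthogonality; for g' = g the weight
    -- of Δ(z) is the diagonal entry l_g^z.
    induction A using OTheta.homog_induction with
    | homog g' A hA =>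
      rw [OTheta.modGroup_apply z hA, OTheta.coreInner_smul_right]
      by_cases hg : g = g'
      · rw [hg]
      · rw [OTheta.coreInner_of_ne hτ hg hB hA, mul_zero, mul_zero]
    | add A C hA hC =>
      rw [map_add, OTheta.coreInner_add_right, OTheta.coreInner_add_right, hA, hC, mul_add]
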